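/- Let $\mathbb F$ be a field of characteristic $0$. An associative interchange algebra over $\mathbb F$ is a vector space with two associative bilinear operations $\circ,\bullet$ satisfying $(a\circ b)\bullet(c\circ d)\equiv(a\bullet c)\circ(b\bullet d)$. In the free associative interchange algebra on countably many generators consider the two Jordan products $\{a,b\}_\circ=a\circ b+b\circ a$ and $\{a,b\}_\bullet=a\bullet b+b\bullet a$. For $n\ge 1$ let $\mathrm{All}(n)$ be the $S_n$-module of multilinear polynomials in $n$ variables $x_1,\dots,x_n$ and two binary operation symbols, in which $S_n$ permutes the variables, that are identities of the two Jordan products. Let $\mathrm{Old}(n)$ be the submodule of those multilinear polynomials that are consequences of the identities in $\mathrm{All}(k)$, $k<n$; here the consequences of a set of identities are the elements of the ideal of the free algebra (with two bilinear operations and no relations) generated by all results of substituting polynomials for the variables in the given identities. (1) A multilinear polynomial of degree $5$ is an identity of the two Jordan products if and only if it is a consequence of the following identities: (i) commutativity $\{a,b\}_*\equiv\{b,a\}_*$ and the linearization of the Jordan identity $\{a,\{b,\{a,a\}_*\}_*\}_*\equiv\{\{a,b\}_*,\{a,a\}_*\}_*$, for each $*\in\{\circ,\bullet\}$; (ii)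 the linearization of $\{\{a,a\}_\circ,\{a,a\}_\circ\}_\bullet-\{\{a,a\}_\bullet,\{a,a\}_\bullet\}_\circ\equiv 0$; (iii) the linearizations of $$\{\{a,b\}_\circ,\{a,\{a,a\}_\circ\}_\circ\}_\bullet-\{\{a,a\}_\bullet,\{b,\{a,a\}_\circ\}_\bullet\}_\circ\equiv 0,$$ $$\{\{a,a\}_\circ,\{b,\{a,a\}_\bullet\}_\circ\}_\bullet-\{\{a,b\}_\bullet,\{a,\{a,a\}_\bullet\}_\bullet\}_\circ\equiv 0.$$ (2) $\mathrm{Old}(5)$ consists of the multilinear polynomials of degree $5$ that are consequences of the identities (i) and (ii). (3) The two linearized identities in (iii) belong to $\mathrm{All}(5)$. In $\mathrm{New}(5)=\mathrm{All}(5)/\mathrm{Old}(5)$ the class of each of them generates a simple $S_5$-submodule isomorphic to $[41]$, the simple $S_5$-module of the partition $4+1$, and $\mathrm{New}(5)$ is the direct sum of these two submodules. Thus there are exactly two new irreducible identities in degree $5$, both for the partition $41$. -/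

import Mathlib

noncomputable section

namespace JJ

/-! ### Free algebras with two bilinear operations -/

/-- The two operation symbols. -/
inductive Op
  | circ
  | bullet

/-- Nonassociative monomials in the variables `X` built with the two operation symbols. -/
inductive Mon (X : Type*)
  | var (x : X) : Mon X
  | mul (o : Op) (l r : Mon X) : Mon X

namespace Mon

variable {X Y A : Type*}

/-- Value of a monomial under given operations and values of the variables. -/
def eval (op : Op → A → A → A) (a : X → A) : Mon X → A
  | var x => a x
  | mul o l r => op o (eval op a l) (eval op a r)

/-- Renaming of variables. -/
def map (g : X → Y) : Mon X → Mon Y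
  | var x => var (g x)
  | mul o l r => mul o (map g l) (map g r)

open Classical in
/-- The number of occurrences of the variable `x`. -/
def count (x : X) : Mon X → ℕ
  | var y => if y = x then 1 else 0
  | mul _ l r => count x l + count x r

/-- Every variable of `X` occurs exactly once. -/
def IsMultilinear (m : Mon X) : Prop := ∀ x, m.count x = 1

theorem map_id (m : Mon X) : m.map id = m := by
  induction m with
  | var x => rfl
  | mul o l r hl hr => simp [map, hl, hr]

theorem map_map {Z : Type*} (h : Y → Z) (g : X → Y) (m : Mon X) :
    (m.map g).map h = m.map (h ∘ g) := by
  induction m with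
  | var x => rfl
  | mul o l r hl hr => simp [map, hl, hr]

theorem eval_map (op : Op → A → A → A) (a : Y → A) (g : X → Y) (m : Mon X) :
    (m.map g).eval op a = m.eval op (a ∘ g) := by
  induction m with
  | var x => rfl
  | mul o l r hl hr => simp [map, eval, hl, hr]

theorem count_map (s : Equiv.Perm X) (x : X) (m : Mon X) :
    (m.map s).count x = m.count (s.symm x) := by
  classical
  induction m with
  | var y =>
    simp only [map, count]
    exact if_congr (Equiv.eq_symm_apply s).symm rfl rfl
  | mul o l r hl hr => simp [map, count, hl, hr]

end Mon

/-- The free algebra over `F` on `X` with two bilinear operations: the vector space whose basis is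
the set of monomials. -/
abbrev Poly (F : Type*) [Field F] (X : Type*) : Type _ := Mon X →₀ F

/-- A pair of bilinear operations on the vector space `A`. -/
abbrev BilinOps (F : Type*) [Field F] (A : Type*) [AddCommGroup A] [Module F A] : Type _ :=
  Op → A →ₗ[F] A →ₗ[F] A

section Field

variable {F : Type*} [Field F]

namespace Poly

variable {X Y A B : Type*} [AddCommGroup A] [Module F A] [AddCommGroup B] [Module F B]

/-- A variable, as an element of the free algebra. -/
def var (x : X) : Poly F X := Finsupp.single (Mon.var x) 1

variable (F X) in
/-- The two operations of the free algebra: the bilinear extensions of the operations on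
monomials. -/
def mul : BilinOps F (Poly F X) := fun o =>
  Finsupp.linearCombination F fun m =>
    Finsupp.linearCombination F fun m' => (Finsupp.single (Mon.mul o m m') (1 : F) : Poly F X)

/-- Evaluation of a polynomial in an algebra with two bilinear operations. -/
def eval (op : BilinOps F A) (a : X → A) : Poly F X →ₗ[F] A :=
  Finsupp.linearCombination F fun m => m.eval (fun o x y => op o x y) a

/-- Substitution of polynomials for the variables. -/
def subst (φ : X → Poly F Y) : Poly F X →ₗ[F] Poly F Y := eval (mul F Y) φ

/-- The linear map that renames the variables. -/
def rename (g : X → Y) : Poly F X →ₗ[F] Poly F Y := Finsupp.lmapDomain F F (Mon.map g)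

theorem rename_mul (g : X → Y) (o : Op) (p q : Poly F X) :
    rename g (mul F X o p q) = mul F Y o (rename g p) (rename g q) := by
  have h : (mul F X o).compr₂ (rename g) = (mul F Y o).compl₁₂ (rename g) (rename g) := by
    ext m m'
    simp [mul, rename, Mon.map]
  simpa using LinearMap.congr_fun₂ h p q

theorem rename_subst {Z : Type*} (g : Y → Z) (φ : X → Poly F Y) (f : Poly F X) :
    rename g (subst φ f) = subst (fun x => rename g (φ x)) f := by
  have h : (rename g).comp (subst φ) = subst (fun x => rename g (φ x)) := by
    refine Finsupp.lhom_ext' fun m => LinearMap.ext_ring ?_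
    simp only [subst, eval, LinearMap.comp_apply, Finsupp.lsingle_apply,
      Finsupp.linearCombination_single, one_smul]
    induction m with
    | var x => rfl
    | mul o l r hl hr => simp only [Mon.eval, rename_mul, hl, hr]
  exact LinearMap.congr_fun h f

theorem eval_rename (op : BilinOps F A) (a : Y → A) (g : X → Y) (f : Poly F X) :
    eval op a (rename g f) = eval op (a ∘ g) f := by
  have h : (eval op a).comp (rename g) = eval op (a ∘ g) := by
    ext m
    simp [eval, rename, Mon.eval_map]
  exact LinearMap.congr_fun h f

end Poly

/-- `f` is a polynomial identity of the algebra `A` with the operations `op`. -/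
def IsIdentity {X A : Type*} [AddCommGroup A] [Module F A] (op : BilinOps F A) (f : Poly F X) :
    Prop :=
  ∀ a : X → A, f.eval op a = 0

/-- The two Jordan products `{x, y} = x * y + y * x`. -/
def jordan {A : Type*} [AddCommGroup A] [Module F A] (op : BilinOps F A) : BilinOps F A :=
  fun o => op o + (op o).flip

/-! ### Ideals and consequences of identities -/

/-- `I` is a two-sided ideal for both operations. -/
def IsIdeal {A : Type*} [AddCommGroup A] [Module F A] (op : BilinOps F A) (I : Submodule F A) :
    Prop :=
  ∀ o x, ∀ y ∈ I, op o x y ∈ I ∧ op o y x ∈ I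

/-- The ideal generated by a set. -/
def idealSpan {A : Type*} [AddCommGroup A] [Module F A] (op : BilinOps F A) (S : Set A) :
    Submodule F A :=
  sInf {I | IsIdeal op I ∧ S ⊆ I}

/-- The consequences in the variables `X` of a collection `S` of identities (`S n` holds the
members of the collection that are written in `n` variables): the ideal of the free algebra on `X`
generated by everything obtained by substituting polynomials for the variables of a member
of `S`. -/
def consequences (S : ∀ n : ℕ, Set (Poly F (Fin n))) (X : Type*) : Submodule F (Poly F X) :=
  idealSpan (Poly.mul F X)
    {g | ∃ n, ∃ f ∈ S n, ∃ φ : Fin n → Poly F X, g = Poly.subst φ f}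

theorem isIdeal_idealSpan {A : Type*} [AddCommGroup A] [Module F A] (op : BilinOps F A)
    (S : Set A) : IsIdeal op (idealSpan op S) := by
  intro o x y hy
  simp only [idealSpan, Submodule.mem_sInf] at hy ⊢
  exact ⟨fun I hI => (hI.1 o x y (hy I hI)).1, fun I hI => (hI.1 o x y (hy I hI)).2⟩

theorem rename_mem_consequences (S : ∀ n : ℕ, Set (Poly F (Fin n))) {X Y : Type*} (g : X → Y)
    {f : Poly F X} (hf : f ∈ consequences S X) : Poly.rename g f ∈ consequences S Y := by
  have h := (Submodule.mem_sInf.1 hf) ((consequences S Y).comap (Poly.rename g)) ?_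
  · exact h
  constructor
  · intro o x y hy
    simp only [Submodule.mem_comap, Poly.rename_mul] at hy ⊢
    exact isIdeal_idealSpan _ _ o _ _ hy
  · rintro _ ⟨n, f, hf, φ, rfl⟩
    refine Submodule.mem_sInf.2 fun I hI => hI.2 ?_
    exact ⟨n, f, hf, fun i => Poly.rename g (φ i), Poly.rename_subst g φ f⟩

/-! ### The free associative interchange algebra -/

variable (F) in
/-- Associativity of both operations, and the interchange identity
`(a ∘ b) • (c ∘ d) = (a • c) ∘ (b • d)`. -/
inductive AssocInterchange : ∀ n : ℕ, Poly F (Fin n) → Prop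
  | assoc (o : Op) : AssocInterchange 3
      (Poly.mul F _ o (Poly.mul F _ o (Poly.var 0) (Poly.var 1)) (Poly.var 2)
        - Poly.mul F _ o (Poly.var 0) (Poly.mul F _ o (Poly.var 1) (Poly.var 2)))
  | interchange : AssocInterchange 4
      (Poly.mul F _ .bullet (Poly.mul F _ .circ (Poly.var 0) (Poly.var 1))
          (Poly.mul F _ .circ (Poly.var 2) (Poly.var 3))
        - Poly.mul F _ .circ (Poly.mul F _ .bullet (Poly.var 0) (Poly.var 2))
          (Poly.mul F _ .bullet (Poly.var 1) (Poly.var 3)))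

variable (F) in
/-- The ideal of the free algebra generated by all instances of associativity and interchange. -/
def interchangeIdeal (X : Type*) : Submodule F (Poly F X) :=
  consequences (fun n => {f | AssocInterchange F n f}) X

variable (F) in
/-- The free associative interchange algebra on `X`. -/
abbrev FreeAI (X : Type*) : Type _ := Poly F X ⧸ interchangeIdeal F X

variable (F) in
/-- The operations of the free associative interchange algebra, induced on the quotient by those of
the free algebra. -/
def FreeAI.op (X : Type*) : BilinOps F (FreeAI F X) := fun o =>
  (interchangeIdeal F X).liftQ
    ((Submodule.mapQLinear (interchangeIdeal F X) (interchangeIdeal F X)).comp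
      ((Poly.mul F X o).codRestrict (Submodule.compatibleMaps _ _)
        fun x y hy => (isIdeal_idealSpan _ _ o x y hy).1))
    (by
      intro x hx
      rw [LinearMap.mem_ker]
      refine Submodule.linearMap_qext _ (LinearMap.ext fun y => ?_)
      exact (Submodule.Quotient.mk_eq_zero _).2 (isIdeal_idealSpan _ _ o y x hx).2)

/-! ### Representations of the symmetric group -/

section SubQuot

variable {G V : Type*} [Group G] [AddCommGroup V] [Module F V]

/-- The quotient of `p` by `q` (more precisely, by the part of `q` that lies in `p`). -/
def SubQuot (p q : Submodule F V) : Type _ := p ⧸ q.submoduleOf p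

instance (p q : Submodule F V) : AddCommGroup (SubQuot p q) :=
  inferInstanceAs (AddCommGroup (p ⧸ q.submoduleOf p))

instance (p q : Submodule F V) : Module F (SubQuot p q) :=
  inferInstanceAs (Module F (p ⧸ q.submoduleOf p))

/-- The class of an element of `p`. -/
def SubQuot.mk {p q : Submodule F V} (v : V) (hv : v ∈ p) : SubQuot p q :=
  (q.submoduleOf p).mkQ ⟨v, hv⟩

/-- The representation induced on the quotient of two invariant subspaces. -/
def subQuotRep (ρ : Representation F G V) (p q : Submodule F V) (hp : ∀ g, p ≤ p.comap (ρ g))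
    (hq : ∀ g, q ≤ q.comap (ρ g)) : Representation F G (SubQuot p q) :=
  (ρ.subrepresentation p hp).quotient (q.submoduleOf p) fun g _ hv => hq g hv

end SubQuot

/-- The subrepresentation generated by a vector. -/
def generatedBy {G V : Type*} [Group G] [AddCommGroup V] [Module F V] (ρ : Representation F G V)
    (v : V) : Subrepresentation ρ where
  toSubmodule := Submodule.span F (Set.range fun g => ρ g v)
  apply_mem_toSubmodule g w hw := by
    induction hw using Submodule.span_induction with
    | mem x hx =>
      obtain ⟨h, rfl⟩ := hx
      refine Submodule.subset_span ⟨g * h, ?_⟩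
      simp
    | zero => simp
    | add x y _ _ hx hy => rw [map_add]; exact add_mem hx hy
    | smul c x _ hx => rw [map_smul]; exact Submodule.smul_mem _ c hx

variable (F) in
/-- The permutation representation of the symmetric group on `F ^ n`. -/
def naturalRep (n : ℕ) : Representation F (Equiv.Perm (Fin n)) (Fin n →₀ F) where
  toFun s := Finsupp.lmapDomain F F s
  map_one' := by
    refine Finsupp.lhom_ext' fun m => LinearMap.ext_ring ?_
    simp
  map_mul' s t := by
    refine Finsupp.lhom_ext' fun m => LinearMap.ext_ring ?_
    simp

variable (F) in
/-- The Specht module of the partition `(n - 1, 1)` of `n ≥ 2`. A tabloid of this shape is given by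
the single entry of its second row, so the permutation module on tabloids is `F ^ n`; the polytabloids
are the differences of two distinct basis vectors. -/
def spechtHook (n : ℕ) :
    Subrepresentation (naturalRep F n) where
  toSubmodule := Submodule.span F
    {v | ∃ i j : Fin n, i ≠ j ∧ v = Finsupp.single i 1 - Finsupp.single j 1}
  apply_mem_toSubmodule g w hw := by
    induction hw using Submodule.span_induction with
    | mem x hx =>
      obtain ⟨i, j, hij, rfl⟩ := hx
      exact Submodule.subset_span ⟨g i, g j, by simpa using hij, by simp [naturalRep, Finsupp.mapDomain_sub]⟩
    | zero => simp
    | add x y _ _ hx hy => rw [map_add]; exact add_mem hx hy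
    | smul c x _ hx => rw [map_smul]; exact Submodule.smul_mem _ c hx

/-! ### Multilinear identities of the two Jordan products -/

variable (F) in
/-- The multilinear polynomials of degree `n`: each of the `n` variables occurs exactly once in
each monomial. -/
def multilinear (n : ℕ) : Submodule F (Poly F (Fin n)) :=
  Finsupp.supported F F {m | m.IsMultilinear}

variable (F) in
/-- The multilinear identities of degree `n` satisfied by the two Jordan products in the free
associative interchange algebra on countably many generators. -/
def allIdentities (n : ℕ) : Submodule F (Poly F (Fin n)) where
  carrier := {f | f ∈ multilinear F n ∧ IsIdentity (jordan (FreeAI.op F ℕ)) f}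
  add_mem' := fun hf hg =>
    ⟨add_mem hf.1 hg.1, fun a => by rw [map_add, hf.2 a, hg.2 a, add_zero]⟩
  zero_mem' := ⟨zero_mem _, fun a => map_zero _⟩
  smul_mem' := fun c f hf =>
    ⟨Submodule.smul_mem _ c hf.1, fun a => by rw [map_smul, hf.2 a, smul_zero]⟩

variable (F) in
/-- The multilinear polynomials of degree `n` that are consequences of the multilinear identities
of the two Jordan products of degree less than `n`. -/
def oldIdentities (n : ℕ) : Submodule F (Poly F (Fin n)) :=
  multilinear F n ⊓ consequences (fun k => {f | k < n ∧ f ∈ allIdentities F k}) (Fin n)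

variable (F) in
/-- The symmetric group permutes the variables. -/
def permRep (n : ℕ) : Representation F (Equiv.Perm (Fin n)) (Poly F (Fin n)) where
  toFun s := Poly.rename s
  map_one' := by
    refine Finsupp.lhom_ext' fun m => LinearMap.ext_ring ?_
    simp [Poly.rename, Mon.map_id, Equiv.Perm.coe_one]
  map_mul' s t := by
    refine Finsupp.lhom_ext' fun m => LinearMap.ext_ring ?_
    simp [Poly.rename, Mon.map_map, Equiv.Perm.coe_mul]

theorem permRep_mem_multilinear {n : ℕ} (s : Equiv.Perm (Fin n)) {f : Poly F (Fin n)}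
    (hf : f ∈ multilinear F n) : permRep F n s f ∈ multilinear F n := by
  classical
  rw [multilinear, Finsupp.mem_supported] at *
  intro m hm
  obtain ⟨m', hm', rfl⟩ := Finset.mem_image.1 (Finsupp.mapDomain_support hm)
  intro x
  rw [Mon.count_map]
  exact hf hm' _

theorem permRep_mem_all {n : ℕ} (s : Equiv.Perm (Fin n)) :
    allIdentities F n ≤ (allIdentities F n).comap (permRep F n s) := fun f hf =>
  ⟨permRep_mem_multilinear s hf.1, fun a =>
    (Poly.eval_rename (jordan (FreeAI.op F ℕ)) a s f).trans (hf.2 _)⟩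

theorem permRep_mem_old {n : ℕ} (s : Equiv.Perm (Fin n)) :
    oldIdentities F n ≤ (oldIdentities F n).comap (permRep F n s) := fun _ hf =>
  ⟨permRep_mem_multilinear s hf.1, rename_mem_consequences _ _ hf.2⟩

variable (F) in
/-- The quotient space of all identities of degree `n` by the old ones. -/
abbrev NewIdentities (n : ℕ) : Type _ := SubQuot (allIdentities F n) (oldIdentities F n)

variable (F) in
/-- The action of the symmetric group on the new identities. -/
def newRep (n : ℕ) : Representation F (Equiv.Perm (Fin n)) (NewIdentities F n) :=
  subQuotRep (permRep F n) (allIdentities F n) (oldIdentities F n) permRep_mem_all permRep_mem_old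

/-- The class of an identity modulo the old identities. -/
def newClass {n : ℕ} (f : Poly F (Fin n)) (hf : f ∈ allIdentities F n) : NewIdentities F n :=
  SubQuot.mk f hf

/-! ### The identities

In the following polynomials the operation symbols stand for the two Jordan products. -/

open Classical in
/-- The complete linearization of `f` with respect to `p : Fin n → X`: replace every variable `x` by
the sum of the new variables `i` with `p i = x`, and keep the multilinear component. -/
def linearize {n : ℕ} {X : Type*} (p : Fin n → X) (f : Poly F X) : Poly F (Fin n) :=
  (Poly.subst (fun x => ∑ i with p i = x, Poly.var i) f).filter Mon.IsMultilinear

variable (F) in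
/-- Commutativity `{a, b} = {b, a}`. -/
def commutativity (o : Op) : Poly F (Fin 2) :=
  Poly.mul F _ o (Poly.var 0) (Poly.var 1) - Poly.mul F _ o (Poly.var 1) (Poly.var 0)

variable (F) in
/-- The Jordan identity `{a, {b, {a, a}}} = {{a, b}, {a, a}}`. -/
def jordanIdentity (o : Op) : Poly F (Fin 2) :=
  let a : Poly F (Fin 2) := Poly.var 0
  let b : Poly F (Fin 2) := Poly.var 1
  let J := Poly.mul F (Fin 2) o
  J a (J b (J a a)) - J (J a b) (J a a)

variable (F) in
/-- The new identity of degree four, in the variable `a`: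
`{{a, a}∘, {a, a}∘}• = {{a, a}•, {a, a}•}∘`. -/
def newJJ4 : Poly F (Fin 1) :=
  let a : Poly F (Fin 1) := Poly.var 0
  let c := Poly.mul F (Fin 1) .circ
  let d := Poly.mul F (Fin 1) .bullet
  d (c a a) (c a a) - c (d a a) (d a a)

variable (F) in
/-- The first new identity of degree five, in the variables `a, b`:
`{{a, b}∘, {a, {a, a}∘}∘}• = {{a, a}•, {b, {a, a}∘}•}∘`. -/
def newJJ51 : Poly F (Fin 2) :=
  let a : Poly F (Fin 2) := Poly.var 0
  let b : Poly F (Fin 2) := Poly.var 1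
  let c := Poly.mul F (Fin 2) .circ
  let d := Poly.mul F (Fin 2) .bullet
  d (c a b) (c a (c a a)) - c (d a a) (d b (c a a))

variable (F) in
/-- The second new identity of degree five, in the variables `a, b`:
`{{a, a}∘, {b, {a, a}•}∘}• = {{a, b}•, {a, {a, a}•}•}∘`. -/
def newJJ52 : Poly F (Fin 2) :=
  let a : Poly F (Fin 2) := Poly.var 0
  let b : Poly F (Fin 2) := Poly.var 1
  let c := Poly.mul F (Fin 2) .circ
  let d := Poly.mul F (Fin 2) .bullet
  d (c a a) (c b (d a a)) - c (d a b) (d a (d a a))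

variable (F) in
/-- The linearization of `newJJ51`. -/
def linJJ51 : Poly F (Fin 5) := linearize (![0, 0, 0, 0, 1] : Fin 5 → Fin 2) (newJJ51 F)

variable (F) in
/-- The linearization of `newJJ52`. -/
def linJJ52 : Poly F (Fin 5) := linearize (![0, 0, 0, 0, 1] : Fin 5 → Fin 2) (newJJ52 F)

variable (F) in
/-- The identities of degree at most four: commutativity and the linearized Jordan identity for
each Jordan product, and the linearization of `newJJ4`. -/
inductive LowerList : ∀ n : ℕ, Poly F (Fin n) → Prop
  | comm (o : Op) : LowerList 2 (commutativity F o)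
  | jordan (o : Op) :
      LowerList 4 (linearize (![0, 0, 0, 1] : Fin 4 → Fin 2) (jordanIdentity F o))
  | new4 : LowerList 4 (linearize (fun _ : Fin 4 => (0 : Fin 1)) (newJJ4 F))

variable (F) in
/-- The identities of degree at most four together with the two linearized new identities of degree
five. -/
inductive FullList : ∀ n : ℕ, Poly F (Fin n) → Prop
  | lower {n : ℕ} {f : Poly F (Fin n)} (h : LowerList F n f) : FullList n f
  | new51 : FullList 5 (linJJ51 F)
  | new52 : FullList 5 (linJJ52 F)

end Field

end JJ

end

open JJ

/-! Let E expand the Jordan products inside the free algebra with the operations ∘ and •. If f is an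
identity of the two Jordan products, then E(f) lies in the interchange ideal. Let L be the space of
consequences of the listed identities of degree at most four. The upper bound on the identities
comes from a left inverse of E up to a factor: `symmetrize` attaches to every monomial m of degree n
≤ 5 a combination S(m) of Jordan monomials such that (a) S(m) and S(m') agree modulo commutativity
whenever m' arises from m by one use of associativity or interchange, so that S maps the interchange
ideal into L; (b) S(E(m)) ≡ N m modulo L, and for n = 5 modulo L and the permuted polynomials
`linJJ51`, `linJJ52`, where the nonzero integer N depends only on n. For an identity f this gives N
f ≡ S(E(f)) ≡ 0, and N is invertible in characteristic 0. In degree three, for instance, S(xyz) =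
{x,{y,z}} + {z,{x,y}} - {y,{x,z}}, which expands to 2(xyz + zyx), and N = 4. For n < 5 the
conclusion is All(n) ⊆ L, which determines Old(5); for n = 5 it gives generators of All(5) modulo L.

Both E and S commute with renaming of variables, so (a) and (b) need only be checked on the finitely
many monomials with consecutively numbered leaves. The kernel does this in `invarianceTest` and
`inverseTest`. The coefficients of S and the tables of relations have no other role than to pass
these tests. The listed identities themselves are verified by rewriting their expansions until all
terms cancel.

For the module structure, write w_i for the class of a new identity with distinguished variable i.
The w_i are permuted like the points 0, ..., 4 and their sum is zero: for b = a the new identity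
becomes a consequence of `newJJ4`. Hence they span a quotient of [41]. That this quotient is not
zero, and that the two new identities are independent, follows from an eight-dimensional commutative
model which satisfies every identity in L. The coefficient of its top basis vector z gives an
equivariant map to F^5 that sends w_i to a nonzero multiple of 5 e_i - ∑ e_j for one of the two
identities and kills the other; exchanging the operations exchanges the two roles. -/

namespace JJ

/-! ### Monomials -/

namespace Op

/-- The other operation symbol. -/
def other : Op → Op
  | circ => bullet
  | bullet => circ

/-- Boolean equality of operation symbols. -/
def beq : Op → Op → Bool
  | circ, circ => true
  | bullet, bullet => true
  | _, _ => false

theorem eq_of_beq {o p : Op} (h : o.beq p = true) : o = p := by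
  cases o <;> cases p <;> simp_all [beq]

end Op

namespace Mon

variable {X Y : Type*}

/-- The number of leaves. -/
def size : Mon X → ℕ
  | var _ => 1
  | mul _ l r => l.size + r.size

/-- The leaves, from left to right. -/
def leaves : Mon X → List X
  | var x => [x]
  | mul _ l r => l.leaves ++ r.leaves

/-- The leftmost leaf. -/
def first : Mon X → X
  | var x => x
  | mul _ l _ => l.first

/-- The `i`-th leaf (the first one if there is no such leaf). -/
def leaf (m : Mon X) (i : ℕ) : X := m.leaves.getD i m.first

/-- Substitution of monomials for the variables. -/
def bind (f : X → Mon Y) : Mon X → Mon Y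
  | var x => f x
  | mul o l r => mul o (l.bind f) (r.bind f)

/-- Exchange of the two operation symbols. -/
def swap : Mon X → Mon X
  | var x => var x
  | mul o l r => mul o.other l.swap r.swap

/-- Replace the leaves by consecutive numbers, starting with `k`. -/
def relabel : ℕ → Mon X → Mon ℕ
  | k, var _ => var k
  | k, mul o l r => mul o (l.relabel k) (r.relabel (k + l.size))

/-- Boolean equality. -/
def beq : Mon ℕ → Mon ℕ → Bool
  | var x, var y => Nat.beq x y
  | mul o l r, mul p l' r' => o.beq p && (l.beq l' && r.beq r')
  | _, _ => false

/-- Boolean equality modulo commutativity. -/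
def beqComm : Mon ℕ → Mon ℕ → Bool
  | var x, var y => Nat.beq x y
  | mul o l r, mul p l' r' =>
    o.beq p && ((l.beqComm l' && r.beqComm r') || (l.beqComm r' && r.beqComm l'))
  | _, _ => false

/-- A numerical invariant of monomials, which distinguishes most of them. -/
def hash : Mon ℕ → ℕ
  | var x => x + 1
  | mul .circ l r => 3 * l.hash + 5 * r.hash + l.hash * r.hash
  | mul .bullet l r => 4 * l.hash + 7 * r.hash + l.hash * r.hash + 1

/-- A numerical invariant of monomials modulo commutativity, which distinguishes most of them. -/
def hashComm : Mon ℕ → ℕ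
  | var x => x + 1
  | mul .circ l r => 3 * (l.hashComm + r.hashComm) + l.hashComm * r.hashComm
  | mul .bullet l r => 5 * (l.hashComm + r.hashComm) + l.hashComm * r.hashComm + 1

/-- The factors of a monomial for the associative operation `o`. -/
def factors (o : Op) : Mon X → List (Mon X)
  | var x => [var x]
  | mul p l r => bif o.beq p then l.factors o ++ r.factors o else [mul p l r]

/-- Associativity applied at the root. -/
def assocStep : Op → Mon X → Mon X → List (Mon X)
  | .circ, mul .circ a b, r => [mul .circ a (mul .circ b r)]
  | .bullet, mul .bullet a b, r => [mul .bullet a (mul .bullet b r)]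
  | _, _, _ => []

/-- The interchange identity applied at the root. -/
def interchangeStep : Op → Mon X → Mon X → List (Mon X)
  | .bullet, mul .circ a b, mul .circ c d => [mul .circ (mul .bullet a c) (mul .bullet b d)]
  | _, _, _ => []

/-- The monomials obtained by one application of associativity or of the interchange identity. -/
def steps : Mon X → List (Mon X)
  | var _ => []
  | mul o l r =>
    l.steps.map (fun l' => mul o l' r) ++ (r.steps.map (mul o l) ++
      (assocStep o l r ++ interchangeStep o l r))

/-- The terms of the expansion of a monomial in the Jordan products. -/
def expand : Mon X → List (Mon X)
  | var x => [var x]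
  | mul o l r => l.expand.flatMap fun a => r.expand.flatMap fun b => [mul o a b, mul o b a]

/-- A numerical invariant that determines the order of the factors in `orient`. -/
def weight : Mon X → ℕ
  | var _ => 2
  | mul .circ l r => 2 * (l.size + r.size)
  | mul .bullet l r => 2 * (l.size + r.size) + 1

/-- The product of `l` and `r` in the order of their weights. -/
def orientedMul (o : Op) (l r : Mon X) : Mon X :=
  bif Nat.ble l.weight r.weight then mul o l r else mul o r l

/-- A representative of a monomial modulo commutativity, chosen by its shape. -/
def orient : Mon X → Mon X
  | var x => var x
  | mul o l r => orientedMul o l.orient r.orient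

/-- All monomials with `n` leaves labelled `k, k + 1, …` from left to right; the first argument
bounds the height. -/
def shapes : ℕ → ℕ → ℕ → List (Mon ℕ)
  | 0, _, _ => []
  | d + 1, n, k =>
    bif Nat.beq n 1 then [var k] else
      (List.range n).flatMap fun i => (shapes d i k).flatMap fun l =>
        (shapes d (n - i) (k + i)).flatMap fun r => [mul .circ l r, mul .bullet l r]

end Mon

/-! ### Integral combinations of monomials -/

/-- Formal integral combinations of monomials. -/
abbrev Comb (X : Type*) : Type _ := List (ℤ × Mon X)

namespace Comb

open Mon

variable {X Y : Type*}

/-- A monomial as a combination. -/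
def of (m : Mon X) : Comb X := [(1, m)]

/-- Multiplication by an integer. -/
def scale (k : ℤ) (l : Comb X) : Comb X := l.map fun p => (k * p.1, p.2)

/-- Apply a function to all monomials. -/
def mapMon (g : Mon X → Mon Y) (l : Comb X) : Comb Y := l.map fun p => (p.1, g p.2)

/-- The product. -/
def mul (o : Op) (p q : Comb X) : Comb X :=
  p.flatMap fun a => q.map fun b => (a.1 * b.1, Mon.mul o a.2 b.2)

/-- Search trees for the terms of a combination, ordered by a numerical invariant. -/
inductive Tree
  | leaf : Tree
  | node (s t : Tree) (h : ℕ) (k : ℤ) (m : Mon ℕ) : Tree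

/-- Add a term to a search tree; terms that are equal in the sense of `e` are collected. -/
def Tree.insert (e : Mon ℕ → Mon ℕ → Bool) (h : ℕ) (k : ℤ) (m : Mon ℕ) : Tree → Tree
  | leaf => node leaf leaf h k m
  | node s t h' k' m' =>
    bif Nat.beq h h' && e m m' then node s t h' (k + k') m'
    else bif Nat.ble h h' then node (s.insert e h k m) t h' k' m'
    else node s (t.insert e h k m) h' k' m'

/-- All coefficients are zero. -/
def Tree.isZero : Tree → Bool
  | leaf => true
  | node s t _ k _ => k == 0 && (s.isZero && t.isZero)

/-- Apply a function to a number; evaluation of `force n f` begins with the evaluation of `n`. -/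
def force {A : Type*} (n : ℕ) (f : ℕ → A) : A :=
  match n with
  | 0 => f 0
  | k + 1 => f (k + 1)

/-- Collect terms that are equal in the sense of `e`, using the invariant `h`. -/
def collect (h : Mon ℕ → ℕ) (e : Mon ℕ → Mon ℕ → Bool) : Comb ℕ → Tree
  | [] => .leaf
  | p :: l => force (h p.2) fun n => (collect h e l).insert e n p.1 p.2

/-- The combination is zero. -/
def isZero (l : Comb ℕ) : Bool := (l.collect hash beq).isZero

/-- The combination is zero modulo commutativity. -/
def isZeroComm (l : Comb ℕ) : Bool := (l.collect hashComm beqComm).isZero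

/-- Substitute the given monomials for the variables, and exchange the operations if `o` is
`bullet`. -/
def inst (l : Comb ℕ) : Op → List (Mon ℕ) → Comb ℕ
  | .circ, v => l.mapMon (bind fun i => v.getD i (var 0))
  | .bullet, v => l.mapMon fun m => m.swap.bind fun i => v.getD i (var 0)

end Comb

/-! ### A left inverse of the expansion of Jordan monomials -/

namespace Symmetrize

open Mon

/-- A variable. -/
scoped instance (n : ℕ) : OfNat (Mon ℕ) n := ⟨var n⟩

/-- Product with the first operation. -/
def c (l r : Mon ℕ) : Mon ℕ := mul .circ l r

/-- Product with the second operation. -/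
def b (l r : Mon ℕ) : Mon ℕ := mul .bullet l r

/-- Symmetrization of a product of three factors. -/
def triple (o : Op) (x y z : Comb ℕ) : Comb ℕ :=
  Comb.mul o x (Comb.mul o y z) ++ (Comb.mul o z (Comb.mul o x y) ++
    (Comb.mul o y (Comb.mul o x z)).scale (-1))

/-- Symmetrization of a product of four factors. -/
def quadruple : Comb ℕ :=
  [(4, c (c 0 1) (c 2 3)), (-4, c (c 0 3) (c 1 2)), (-8, c 1 (c 3 (c 0 2))),
   (18, c 0 (c 1 (c 2 3))), (10, c 1 (c 2 (c 0 3))), (2, c 0 (c 2 (c 1 3))),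
   (-16, c 2 (c 3 (c 0 1)))]

/-- Symmetrization of `(0 ∘ 1) • (2 ∘ 3)`. -/
def square : Comb ℕ :=
  [(5, b (c 0 1) (c 2 3)), (1, b (c 0 2) (c 1 3)), (-3, b (c 0 3) (c 1 2)),
   (5, c (b 0 2) (b 1 3)), (1, c (b 0 1) (b 2 3)), (-3, c (b 0 3) (b 1 2))]

/-- Symmetrization of a product of five factors. -/
def quintuple : Comb ℕ :=
  [(20, c 0 (c 4 (c 1 (c 2 3)))), (60, c 1 (c 4 (c 2 (c 0 3)))), (-140, c (c 1 2) (c 0 (c 3 4))),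
   (120, c 0 (c 1 (c 2 (c 3 4)))), (-20, c 1 (c 0 (c 2 (c 3 4)))), (-140, c 1 (c 4 (c 0 (c 2 3)))),
   (-40, c 0 (c 1 (c 3 (c 2 4)))), (40, c 4 (c 2 (c 1 (c 0 3)))), (20, c 3 (c 2 (c 1 (c 0 4)))),
   (80, c 0 (c 3 (c 1 (c 2 4)))), (30, c 2 (c 1 (c 3 (c 0 4)))), (20, c 2 (c (c 0 3) (c 1 4))),
   (30, c 2 (c 4 (c 3 (c 0 1)))), (60, c 3 (c 1 (c 2 (c 0 4)))), (-40, c 3 (c 0 (c 1 (c 2 4)))),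
   (40, c 4 (c (c 0 1) (c 2 3))), (-50, c 2 (c 4 (c 1 (c 0 3)))), (-100, c (c 2 4) (c 0 (c 1 3))),
   (40, c (c 0 1) (c 4 (c 2 3)))]

/-- Symmetrization of `(0 ∘ 1) • (2 ∘ 3 ∘ 4)`. -/
def rectangle : Comb ℕ :=
  [(8, b (c 0 4) (c 3 (c 1 2))), (-30, b (c 0 1) (c 3 (c 2 4))), (76, b (c 0 1) (c 4 (c 2 3))),
   (32, b (c 0 2) (c 1 (c 3 4))), (-8, b (c 3 4) (c 1 (c 0 2))), (-16, c (b 0 1) (b 2 (c 3 4))),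
   (8, b (c 2 3) (c 1 (c 0 4))), (16, c (b 1 3) (b 4 (c 0 2))), (16, c (b 0 2) (b 1 (c 3 4))),
   (-48, c (b 0 4) (b 1 (c 2 3))), (-8, b (c 0 2) (c 3 (c 1 4))), (-16, c (b 1 3) (b 2 (c 0 4)))]

/-- Symmetrization in degrees at most three. -/
def upToThree : Mon ℕ → Comb ℕ
  | var x => .of (var x)
  | mul o l r => match factors o (mul o l r) with
    | [x, y, z] => triple o (.of x) (.of y) (.of z)
    | _ => .of (mul o l r)

/-- Symmetrization of a product of two products of two variables. -/
def squareOf (o : Op) : Mon ℕ → Mon ℕ → Comb ℕ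
  | mul _ x y, mul _ z w => square.inst o.other [x, y, z, w]
  | x, y => (Comb.mul o (upToThree x) (upToThree y)).scale 6

/-- Symmetrization in degree four. -/
def four : Mon ℕ → Comb ℕ
  | var _ => []
  | mul o l r => match factors o (mul o l r) with
    | [x, y, z, w] => quadruple.inst o [x, y, z, w]
    | [x, y, z] => (triple o (.of x) (.of y) (.of z)).scale 6
    | [x, y] => bif Nat.beq x.size 2 then squareOf o x y
        else (Comb.mul o (upToThree x) (upToThree y)).scale 6
    | _ => []

/-- Symmetrization of the product of a variable `x` and two adjacent products `y`, `z` of two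
variables; `k` is `1` or `-1` according to the side on which `x` stands. -/
def adjacent (o : Op) (k : ℤ) (x y z : Mon ℕ) : Comb ℕ :=
  (Comb.mul o (.of x) (squareOf o y z)).scale 5 ++
    [(30 * k, mul o z (mul o x y)), (-30 * k, mul o y (mul o x z))]

/-- The columns of a product of two products of two variables. -/
def columns (o : Op) : Mon ℕ → Option (Mon ℕ × Mon ℕ)
  | mul p (mul q x y) (mul q' z w) =>
    bif Nat.beq (x.size + y.size + z.size + w.size) 4 && (o.beq q && o.beq q') then
      some (mul p x z, mul p y w) else none
  | _ => none

/-- Symmetrization of the product with the operation `o` of `x` and `y`, one of which is a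
variable. -/
def withVariable (o : Op) (k : ℤ) (x y : Mon ℕ) : Comb ℕ :=
  match columns o y with
  | some (z, w) => adjacent o k x z w
  | none => (Comb.mul o (.of x) (four y)).scale 5

/-- Symmetrization of the product of two rows with two and three entries. -/
def rows (o : Op) (x y : List (Mon ℕ)) : Comb ℕ :=
  bif Nat.beq x.length 2 then rectangle.inst o.other (x ++ y)
  else rectangle.inst o.other (y ++ x)

/-- Symmetrization of the product of a product of two variables and one of three variables. -/
def pair (o : Op) (x y : List (Mon ℕ)) : Comb ℕ :=
  match x, y with
  | [x₁, x₂], [y₁, y₂] =>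
    rows o.other (factors o x₁ ++ factors o y₁) (factors o x₂ ++ factors o y₂)
  | _, _ => rows o x y

/-- Symmetrization in degree five. -/
def five : Mon ℕ → Comb ℕ
  | var _ => []
  | mul o l r => match factors o (mul o l r) with
    | [x, y, z, v, w] => quintuple.inst o [x, y, z, v, w]
    | [x, y, z, w] => (quadruple.inst o [x, y, z, w]).scale 5
    | [x, y, z] =>
      bif Nat.beq x.size 1 && (Nat.beq y.size 2 && Nat.beq z.size 2) then adjacent o 1 x y z
      else bif Nat.beq z.size 1 && (Nat.beq x.size 2 && Nat.beq y.size 2) then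
        adjacent o (-1) z x y
      else (triple o (upToThree x) (upToThree y) (upToThree z)).scale 30
    | [x, y] =>
      bif Nat.beq x.size 1 then withVariable o 1 x y
      else bif Nat.beq y.size 1 then withVariable o (-1) y x
      else pair o (factors o.other x) (factors o.other y)
    | _ => []

/-- Symmetrization of monomials of degree `n` whose leaves are numbered. -/
def ofDegree : ℕ → Mon ℕ → Comb ℕ
  | 5 => five
  | 4 => four
  | _ => upToThree

/-- The factor by which symmetrization after expansion multiplies a monomial of degree `n`. -/
def factor : ℕ → ℤ
  | 5 => 480
  | 4 => 48
  | 3 => 4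
  | 2 => 2
  | _ => 1

end Symmetrize

/-- A combination of monomials in the Jordan products attached to a monomial `m` of degree `n` in
two associative operations. -/
def symmetrize {X : Type*} (n : ℕ) (m : Mon X) : Comb X :=
  (Symmetrize.ofDegree n (m.relabel 0)).mapMon (Mon.map m.leaf)

/-! ### Linearizations as combinations -/

namespace Mon

/-- Replace the variables in all possible ways by numbers `i < n` with the prescribed value
under `p`. -/
def spread {n k : ℕ} (p : Fin n → Fin k) : Mon (Fin k) → List (Mon (Fin n))
  | var x => ((List.finRange n).filter fun i => Nat.beq (p i) x).map var
  | mul o l r => (l.spread p).flatMap fun a => (r.spread p).map (mul o a)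

/-- Decides whether every variable occurs exactly once. -/
def multilinearTest {n : ℕ} (m : Mon (Fin n)) : Bool :=
  (List.finRange n).all fun i => Nat.beq (m.leaves.countP fun j : Fin n => Nat.beq j i) 1

end Mon

namespace Comb

/-- The linearization of a combination. -/
def linearize {n k : ℕ} (p : Fin n → Fin k) (l : Comb (Fin k)) : Comb (Fin n) :=
  l.flatMap fun q => ((q.2.spread p).filter Mon.multilinearTest).map fun m => (q.1, m)

/-- Forget the bound on the variables. -/
def toNat {n : ℕ} (l : Comb (Fin n)) : Comb ℕ := l.mapMon (Mon.map Fin.val)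

end Comb

namespace Mon

/-- The two sides of the Jordan identity. -/
def jordanComb (o : Op) : Comb (Fin 2) :=
  [(1, mul o (var 0) (mul o (var 1) (mul o (var 0) (var 0)))),
   (-1, mul o (mul o (var 0) (var 1)) (mul o (var 0) (var 0)))]

/-- The two sides of the identity `newJJ4`. -/
def newComb4 : Comb (Fin 1) :=
  [(1, mul .bullet (mul .circ (var 0) (var 0)) (mul .circ (var 0) (var 0))),
   (-1, mul .circ (mul .bullet (var 0) (var 0)) (mul .bullet (var 0) (var 0)))]

/-- The two sides of the identities `newJJ51` and `newJJ52`. -/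
def newComb5 : Op → Comb (Fin 2)
  | .circ =>
    [(1, mul .bullet (mul .circ (var 0) (var 1))
        (mul .circ (var 0) (mul .circ (var 0) (var 0)))),
     (-1, mul .circ (mul .bullet (var 0) (var 0))
        (mul .bullet (var 1) (mul .circ (var 0) (var 0))))]
  | .bullet =>
    [(1, mul .bullet (mul .circ (var 0) (var 0))
        (mul .circ (var 1) (mul .bullet (var 0) (var 0)))),
     (-1, mul .circ (mul .bullet (var 0) (var 1))
        (mul .bullet (var 0) (mul .bullet (var 0) (var 0))))]

end Mon

/-- The linearized Jordan identity. -/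
def jordanLin (o : Op) : Comb (Fin 4) := (Mon.jordanComb o).linearize ![0, 0, 0, 1]

/-- The linearization of `newJJ4`. -/
def newLin4 : Comb (Fin 4) := Mon.newComb4.linearize fun _ => 0

/-- The linearizations of `newJJ51` and `newJJ52`. -/
def newLin5 (o : Op) : Comb (Fin 5) := (Mon.newComb5 o).linearize ![0, 0, 0, 0, 1]

/-- Half of the linearized Jordan identity, up to commutativity. -/
def jordanTerms (o : Op) (x y z w : Mon ℕ) : Comb ℕ :=
  [(1, .mul o x (.mul o w (.mul o y z))), (1, .mul o y (.mul o w (.mul o x z))),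
   (1, .mul o z (.mul o w (.mul o x y))), (-1, .mul o (.mul o x w) (.mul o y z)),
   (-1, .mul o (.mul o y w) (.mul o x z)), (-1, .mul o (.mul o z w) (.mul o x y))]

/-- One eighth of the linearization of `newJJ4`, up to commutativity. -/
def newTerms4 (x y z w : Mon ℕ) : Comb ℕ :=
  [(1, .mul .bullet (.mul .circ x y) (.mul .circ z w)),
   (1, .mul .bullet (.mul .circ x z) (.mul .circ y w)),
   (1, .mul .bullet (.mul .circ x w) (.mul .circ y z)),
   (-1, .mul .circ (.mul .bullet x y) (.mul .bullet z w)),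
   (-1, .mul .circ (.mul .bullet x z) (.mul .bullet y w)),
   (-1, .mul .circ (.mul .bullet x w) (.mul .bullet y z))]

/-- The orders of `0, 1, 2, 3` in which the last two numbers are increasing. -/
def arrangements : List (ℕ × ℕ × ℕ × ℕ) :=
  [(0, 1, 2, 3), (0, 2, 1, 3), (0, 3, 1, 2), (1, 0, 2, 3), (1, 2, 0, 3), (1, 3, 0, 2),
   (2, 0, 1, 3), (2, 1, 0, 3), (2, 3, 0, 1), (3, 0, 1, 2), (3, 1, 0, 2), (3, 2, 0, 1)]

section

open Symmetrize Mon

/-- Half of the linearization of `newJJ51` or `newJJ52`, up to commutativity. -/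
def newTerms5 : Op → Comb ℕ
  | .circ => arrangements.flatMap fun p =>
    [(1, b (c (var p.1) 4) (c (var p.2.1) (c (var p.2.2.1) (var p.2.2.2)))),
     (-1, c (b (var p.1) (var p.2.1)) (b 4 (c (var p.2.2.1) (var p.2.2.2))))]
  | .bullet => arrangements.flatMap fun p =>
    [(1, b (c (var p.1) (var p.2.1)) (c 4 (b (var p.2.2.1) (var p.2.2.2)))),
     (-1, c (b (var p.1) 4) (b (var p.2.1) (b (var p.2.2.1) (var p.2.2.2))))]

end

/-! ### Certificates -/

/-- Multilinear consequences of the Jordan identities and of `newJJ4`. -/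
inductive Rel
  | jordan (o : Op) (x y z w : Mon ℕ)
  | interchange (x y z w : Mon ℕ)
  | under (o : Op) (x : Mon ℕ) (r : Rel)

namespace Rel

/-- The combination that a relation stands for. -/
def comb : Rel → Comb ℕ
  | jordan o x y z w => jordanTerms o x y z w
  | interchange x y z w => newTerms4 x y z w
  | under o x r => Comb.mul o (.of x) r.comb

/-- Exchange of the two operations; the combination of `interchange` changes its sign. -/
def swap : ℤ × Rel → ℤ × Rel
  | (k, jordan o x y z w) => (k, jordan o.other x.swap y.swap z.swap w.swap)
  | (k, interchange x y z w) => (-k, interchange x.swap y.swap z.swap w.swap)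
  | (k, under o x r) => ((swap (k, r)).1, under o.other x.swap (swap (k, r)).2)

end Rel

/-- The exchange of `i` and `4`. -/
def swapFour (i j : ℕ) : ℕ := bif Nat.beq j i then 4 else bif Nat.beq j 4 then i else j

/-- Half of the linearization of `newJJ51` or `newJJ52` with the distinguished variable `i`. -/
def hook (o : Op) (i : ℕ) : Comb ℕ := (newTerms5 o).mapMon (Mon.map (swapFour i))

section Certificates

open Symmetrize

/-- For some monomials with root `circ`, the relations needed to bring symmetrization after
expansion into the form of a multiple of the identity. -/
def relTable : List (Mon ℕ × List (ℤ × Rel)) :=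
  [(c 0 (c 1 (c 2 3)),
    [(-22, .jordan .circ 0 1 3 2), (12, .jordan .circ 0 2 3 1),
      (-22, .jordan .circ 0 1 2 3), (32, .jordan .circ 1 2 3 0)]),
   (c (c 0 1) (c 2 3),
    [(-4, .jordan .circ 0 1 3 2), (-4, .jordan .circ 0 2 3 1),
      (-4, .jordan .circ 0 1 2 3), (-4, .jordan .circ 1 2 3 0)]),
   (c (b 0 1) (b 2 3),
    [(-8, .interchange 0 1 2 3)]),
   (c 0 (c 1 (c 2 (c 3 4))),
    [(-200, .under .circ 1 (.jordan .circ 0 2 3 4)), (140, .jordan .circ (c 2 3) 0 4 1),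
      (90, .under .circ 4 (.jordan .circ 0 1 2 3)), (-110, .under .circ 2 (.jordan .circ 0 1 4 3)),
      (-280, .jordan .circ (c 0 2) 3 4 1), (90, .under .circ 3 (.jordan .circ 0 1 2 4)),
      (140, .jordan .circ (c 1 4) 2 3 0), (-200, .jordan .circ (c 0 1) 2 4 3),
      (140, .jordan .circ (c 3 4) 0 1 2), (200, .jordan .circ (c 2 3) 1 4 0),
      (200, .jordan .circ (c 2 4) 1 3 0), (-240, .jordan .circ 0 2 3 (c 1 4)),
      (-180, .under .circ 0 (.jordan .circ 2 3 4 1)), (-10, .under .circ 4 (.jordan .circ 0 2 3 1)),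
      (-500, .jordan .circ 0 1 4 (c 2 3)), (20, .under .circ 2 (.jordan .circ 0 3 4 1)),
      (-200, .under .circ 0 (.jordan .circ 1 2 3 4)), (-80, .under .circ 0 (.jordan .circ 1 3 4 2)),
      (280, .jordan .circ 1 3 4 (c 0 2)), (140, .under .circ 1 (.jordan .circ 2 3 4 0)),
      (-200, .under .circ 1 (.jordan .circ 0 2 4 3)), (-110, .under .circ 2 (.jordan .circ 0 1 3 4)),
      (540, .jordan .circ 2 3 4 (c 0 1)), (-10, .under .circ 3 (.jordan .circ 0 2 4 1)),
      (-280, .jordan .circ (c 0 1) 3 4 2), (-240, .jordan .circ 0 2 4 (c 1 3)),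
      (140, .jordan .circ (c 1 3) 2 4 0), (-200, .jordan .circ (c 0 1) 2 3 4),
      (200, .jordan .circ (c 3 4) 1 2 0), (-200, .under .circ 0 (.jordan .circ 1 2 4 3)),
      (140, .jordan .circ (c 2 4) 0 3 1), (-820, .jordan .circ 0 1 2 (c 3 4)),
      (-500, .jordan .circ 0 1 3 (c 2 4)), (280, .jordan .circ (c 3 4) 0 2 1),
      (-200, .under .circ 1 (.jordan .circ 0 3 4 2))]),
   (c 0 (c 1 (c 2 (b 3 4))),
    [(120, .jordan .circ (b 3 4) 0 2 1), (320, .jordan .circ (b 3 4) 1 2 0),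
      (-220, .jordan .circ (b 3 4) 0 1 2), (-220, .jordan .circ 0 1 2 (b 3 4))]),
   (c 0 (b 1 (b 2 (b 3 4))),
    [(-220, .under .circ 0 (.jordan .bullet 1 2 4 3)), (120, .under .circ 0 (.jordan .bullet 1 3 4 2)),
      (-220, .under .circ 0 (.jordan .bullet 1 2 3 4)), (320, .under .circ 0 (.jordan .bullet 2 3 4 1))]),
   (c 0 (c (c 1 2) (c 3 4)),
    [(240, .under .circ 2 (.jordan .circ 1 3 4 0)), (140, .jordan .circ (c 1 3) 0 4 2),
      (140, .jordan .circ (c 1 4) 2 3 0), (-560, .jordan .circ 0 1 2 (c 3 4)),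
      (140, .jordan .circ (c 1 4) 0 3 2), (-240, .under .circ 0 (.jordan .circ 1 2 4 3)),
      (220, .under .circ 3 (.jordan .circ 0 1 2 4)), (-110, .under .circ 1 (.jordan .circ 0 2 3 4)),
      (-110, .under .circ 2 (.jordan .circ 0 1 4 3)), (-480, .jordan .circ 0 1 3 (c 2 4)),
      (-240, .jordan .circ (c 3 4) 0 2 1), (140, .jordan .circ (c 2 3) 1 4 0),
      (-110, .under .circ 4 (.jordan .circ 0 2 3 1)), (220, .under .circ 4 (.jordan .circ 0 1 2 3)),
      (-240, .under .circ 0 (.jordan .circ 2 3 4 1)), (-180, .under .circ 1 (.jordan .circ 0 3 4 2)),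
      (-110, .under .circ 1 (.jordan .circ 0 2 4 3)), (-240, .jordan .circ 0 2 3 (c 1 4)),
      (-180, .under .circ 2 (.jordan .circ 0 3 4 1)), (-110, .under .circ 3 (.jordan .circ 0 2 4 1)),
      (140, .jordan .circ (c 1 3) 2 4 0), (-110, .under .circ 2 (.jordan .circ 0 1 3 4)),
      (140, .jordan .circ (c 2 4) 1 3 0), (400, .jordan .circ (c 3 4) 1 2 0),
      (140, .jordan .circ (c 2 4) 0 1 3), (160, .jordan .circ 1 3 4 (c 0 2)),
      (140, .jordan .circ (c 2 3) 0 4 1), (400, .jordan .circ 2 3 4 (c 0 1)),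
      (-240, .jordan .circ 0 2 4 (c 1 3)), (140, .jordan .circ (c 2 3) 0 1 4),
      (-480, .jordan .circ 0 1 4 (c 2 3)), (-100, .jordan .circ (c 1 3) 0 2 4),
      (-400, .jordan .circ (c 0 1) 3 4 2), (140, .jordan .circ (c 2 4) 0 3 1),
      (-100, .jordan .circ (c 1 4) 0 2 3), (-110, .under .circ 3 (.jordan .circ 0 1 4 2)),
      (-400, .jordan .circ (c 0 2) 3 4 1), (-240, .under .circ 0 (.jordan .circ 1 2 3 4)),
      (-110, .under .circ 4 (.jordan .circ 0 1 3 2))]),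
   (c 0 (b (c 1 2) (c 3 4)),
    [(80, .under .circ 0 (.interchange 1 2 3 4))]),
   (c 0 (c (c 1 2) (b 3 4)),
    [(-220, .jordan .circ (b 3 4) 0 2 1), (320, .jordan .circ (b 3 4) 1 2 0),
      (-220, .jordan .circ (b 3 4) 0 1 2), (120, .jordan .circ 0 1 2 (b 3 4))]),
   (c 0 (c (b 1 2) (b 3 4)),
    [(-80, .under .circ 0 (.interchange 1 2 3 4))]),
   (c 0 (b (b 1 2) (b 3 4)),
    [(-40, .under .circ 0 (.jordan .bullet 1 2 4 3)), (-40, .under .circ 0 (.jordan .bullet 1 3 4 2)),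
      (-40, .under .circ 0 (.jordan .bullet 1 2 3 4)), (-40, .under .circ 0 (.jordan .bullet 2 3 4 1))]),
   (c (c 0 1) (c 2 (c 3 4)),
    [(20, .under .circ 2 (.jordan .circ 1 3 4 0)), (60, .jordan .circ (c 2 3) 1 4 0),
      (-80, .jordan .circ (c 3 4) 1 2 0), (-80, .under .circ 1 (.jordan .circ 0 2 3 4)),
      (-120, .under .circ 0 (.jordan .circ 1 3 4 2)), (-10, .under .circ 4 (.jordan .circ 0 2 3 1)),
      (280, .jordan .circ (c 3 4) 0 1 2), (-100, .jordan .circ (c 0 3) 2 4 1),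
      (-120, .under .circ 1 (.jordan .circ 0 3 4 2)), (-40, .under .circ 0 (.jordan .circ 2 3 4 1)),
      (-40, .jordan .circ 0 1 4 (c 2 3)), (220, .jordan .circ (c 1 4) 2 3 0),
      (-80, .under .circ 0 (.jordan .circ 1 2 3 4)), (20, .under .circ 2 (.jordan .circ 0 3 4 1)),
      (-60, .under .circ 3 (.jordan .circ 0 1 2 4)), (-80, .jordan .circ (c 3 4) 0 2 1),
      (-320, .jordan .circ (c 0 1) 2 4 3), (-60, .under .circ 4 (.jordan .circ 0 1 2 3)),
      (-200, .under .circ 3 (.jordan .circ 0 1 4 2)), (120, .under .circ 4 (.jordan .circ 0 1 3 2)),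
      (20, .under .circ 2 (.jordan .circ 0 1 3 4)), (60, .jordan .circ (c 2 3) 0 4 1),
      (220, .jordan .circ (c 0 4) 2 3 1), (60, .jordan .circ (c 2 4) 1 3 0),
      (60, .jordan .circ (c 2 4) 0 3 1), (-100, .jordan .circ (c 1 3) 2 4 0),
      (-360, .jordan .circ 0 1 3 (c 2 4)), (-400, .jordan .circ 0 1 2 (c 3 4)),
      (-10, .under .circ 4 (.jordan .circ 1 2 3 0)), (-80, .under .circ 0 (.jordan .circ 1 2 4 3)),
      (-320, .jordan .circ 0 2 3 (c 1 4)), (-40, .under .circ 1 (.jordan .circ 2 3 4 0)),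
      (-10, .under .circ 3 (.jordan .circ 1 2 4 0)), (-10, .under .circ 3 (.jordan .circ 0 2 4 1)),
      (40, .jordan .circ (c 0 1) 3 4 2), (-80, .under .circ 1 (.jordan .circ 0 2 4 3)),
      (-320, .jordan .circ 1 2 3 (c 0 4)), (-300, .under .circ 2 (.jordan .circ 0 1 4 3))]),
   (c (c 0 1) (c 2 (b 3 4)),
    [(-40, .jordan .circ (b 3 4) 0 2 1), (-40, .jordan .circ (b 3 4) 1 2 0),
      (-40, .jordan .circ (b 3 4) 0 1 2), (-40, .jordan .circ 0 1 2 (b 3 4))]),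
   (c (b 0 1) (c 2 (c 3 4)),
    [(-220, .jordan .circ (b 0 1) 2 4 3), (120, .jordan .circ (b 0 1) 3 4 2),
      (-220, .jordan .circ (b 0 1) 2 3 4), (320, .jordan .circ 2 3 4 (b 0 1))]),
   (c (b 0 1) (b 2 (c 3 4)),
    [(32, .interchange (c 2 4) 0 1 3), (-256, .interchange (c 3 4) 0 1 2),
      (96, .interchange (c 0 1) 2 3 4), (32, .interchange (c 2 3) 0 1 4)]),
   (c (b 0 1) (c 2 (b 3 4)),
    [(-40, .under .circ 2 (.interchange 0 1 3 4))]),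
   (c (b 0 1) (b 2 (b 3 4)),
    [(64, .interchange (b 2 3) 0 1 4), (64, .interchange (b 2 4) 0 1 3),
      (128, .interchange (b 3 4) 0 1 2)]),
   (c 0 (c (b 1 2) (c 3 4)),
    [(-220, .jordan .circ (b 1 2) 0 4 3), (320, .jordan .circ (b 1 2) 3 4 0),
      (-220, .jordan .circ (b 1 2) 0 3 4), (120, .jordan .circ 0 3 4 (b 1 2))])]

/-- As `relTable`, for the relations of degree five that do not follow from lower degree. -/
def hookTable : List (Mon ℕ × List (ℤ × ℕ)) :=
  [(c (b 0 1) (b 2 (c 3 4)), [(-48, 2), (-16, 4), (-16, 3)])]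

end Certificates

/-- Look up a monomial in a table. -/
def lookupMon {A : Type*} (m : Mon ℕ) : List (Mon ℕ × List A) → List A
  | [] => []
  | p :: t => bif m.beq p.1 then p.2 else lookupMon m t

/-- The relations of lower degree for a given monomial. -/
def relsOf : Mon ℕ → List (ℤ × Rel)
  | .mul .bullet l r => (lookupMon (Mon.mul .bullet l r).swap relTable).map Rel.swap
  | m => lookupMon m relTable

/-- The new relations of degree five for a given monomial. -/
def hooksOf : Mon ℕ → List (ℤ × Op × ℕ)
  | .mul .bullet l r =>
    (lookupMon (Mon.mul .bullet l r).swap hookTable).map fun p => (-p.1, .bullet, p.2)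
  | m => (lookupMon m hookTable).map fun p => (p.1, .circ, p.2)

/-- The combination of all relations for a given monomial. -/
def certificate (m : Mon ℕ) : Comb ℕ :=
  ((relsOf m).flatMap fun p => p.2.comb.scale p.1) ++
    (hooksOf m).flatMap fun p => (hook p.2.1 p.2.2).scale p.1

/-! ### The two finite tests -/

/-- Symmetrization is compatible with associativity and the interchange identity. -/
def invarianceTest (n : ℕ) : Bool :=
  (Mon.shapes n n 0).all fun s => s.steps.all fun t =>
    Comb.isZeroComm (symmetrize n s ++ (symmetrize n t).scale (-1))

/-- Symmetrization after expansion is a multiple of the identity modulo the relations. -/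
def inverseTest (n : ℕ) : Bool :=
  (Mon.shapes n n 0).all fun s => !(s.beq s.orient) ||
    Comb.isZeroComm ((s.expand.flatMap (symmetrize n)) ++
      ((-Symmetrize.factor n, s) :: certificate s))

end JJ

namespace JJ

/-! ### Soundness of the computations -/

namespace Mon

variable {X Y : Type*}

theorem beq_sound {m n : Mon ℕ} (h : m.beq n = true) : m = n := by
  induction m generalizing n with
  | var x =>
    cases n with
    | var y => exact congrArg var (Nat.eq_of_beq_eq_true h)
    | mul o l r => simp [beq] at h
  | mul o l r hl hr =>
    cases n with
    | var y => simp [beq] at h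
    | mul p l' r' =>
      simp only [beq, Bool.and_eq_true] at h
      rw [Op.eq_of_beq h.1, hl h.2.1, hr h.2.2]

/-- Equality of monomials modulo commutativity. -/
inductive CommRel : Mon X → Mon X → Prop
  | refl (m : Mon X) : CommRel m m
  | mul (o : Op) {l r l' r' : Mon X} (hl : CommRel l l') (hr : CommRel r r') :
      CommRel (mul o l r) (mul o l' r')
  | comm (o : Op) {l r l' r' : Mon X} (hl : CommRel l r') (hr : CommRel r l') :
      CommRel (mul o l r) (mul o l' r')

theorem commRel_of_beqComm {m n : Mon ℕ} (h : m.beqComm n = true) : CommRel m n := by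
  induction m generalizing n with
  | var x =>
    cases n with
    | var y => rw [Nat.eq_of_beq_eq_true h]; exact .refl _
    | mul o l r => simp [beqComm] at h
  | mul o l r hl hr =>
    cases n with
    | var y => simp [beqComm] at h
    | mul p l' r' =>
      simp only [beqComm, Bool.and_eq_true, Bool.or_eq_true] at h
      obtain ⟨ho, h⟩ := h
      cases Op.eq_of_beq ho
      rcases h with h | h
      · exact .mul _ (hl h.1) (hr h.2)
      · exact .comm _ (hl h.1) (hr h.2)

theorem commRel_orient (m : Mon X) : CommRel m.orient m := by
  induction m with
  | var x => exact .refl _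
  | mul o l r hl hr =>
    simp only [orient, orientedMul]
    cases Nat.ble l.orient.weight r.orient.weight
    · exact .comm _ hr hl
    · exact .mul _ hl hr

theorem CommRel.map (g : X → Y) {m n : Mon X} (h : CommRel m n) :
    CommRel (m.map g) (n.map g) := by
  induction h with
  | refl m => exact .refl _
  | mul o _ _ hl hr => exact .mul o hl hr
  | comm o _ _ hl hr => exact .comm o hl hr

theorem size_pos (m : Mon X) : 0 < m.size := by
  induction m with
  | var x => simp [size]
  | mul o l r hl hr => simp only [size]; omega

theorem length_leaves (m : Mon X) : m.leaves.length = m.size := by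
  induction m with
  | var x => rfl
  | mul o l r hl hr => simp [leaves, size, hl, hr]

theorem size_map (g : X → Y) (m : Mon X) : (m.map g).size = m.size := by
  induction m with
  | var x => rfl
  | mul o l r hl hr => simp [map, size, hl, hr]

theorem leaves_map (g : X → Y) (m : Mon X) : (m.map g).leaves = m.leaves.map g := by
  induction m with
  | var x => rfl
  | mul o l r hl hr => simp [map, leaves, hl, hr]

theorem first_map (g : X → Y) (m : Mon X) : (m.map g).first = g m.first := by
  induction m with
  | var x => rfl
  | mul o l r hl hr => simp [map, first, hl]

theorem leaf_map (g : X → Y) (m : Mon X) (i : ℕ) : (m.map g).leaf i = g (m.leaf i) := by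
  simp only [leaf, leaves_map, first_map, List.getD_map]

theorem relabel_map (g : X → Y) (m : Mon X) (k : ℕ) : (m.map g).relabel k = m.relabel k := by
  induction m generalizing k with
  | var x => rfl
  | mul o l r hl hr => simp [map, relabel, hl, hr, size_map]

theorem size_relabel (m : Mon X) (k : ℕ) : (m.relabel k).size = m.size := by
  induction m generalizing k with
  | var x => rfl
  | mul o l r hl hr => simp [relabel, size, hl, hr]

theorem map_relabel_aux (m : Mon X) (k : ℕ) (g : ℕ → X)
    (hg : ∀ i (hi : i < m.leaves.length), g (k + i) = m.leaves[i]) :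
    (m.relabel k).map g = m := by
  induction m generalizing k with
  | var x => simpa [relabel, map, leaves] using hg 0 (by simp [leaves])
  | mul o l r hl hr =>
    simp only [relabel, map]
    rw [hl k fun i hi => ?_, hr _ fun i hi => ?_]
    · rw [add_assoc, ← length_leaves, hg _ (by simpa [leaves] using hi)]
      simp [leaves]
    · rw [hg i (by simp [leaves]; omega)]
      simp [leaves, List.getElem_append_left hi]

/-- A monomial is recovered from its numbered shape by renaming along its leaves. Since steps,
expansion and symmetrization commute with renaming, a test on shapes covers all monomials in all
sets of variables. -/
theorem map_relabel (m : Mon X) : (m.relabel 0).map m.leaf = m :=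
  map_relabel_aux m 0 _ fun i hi => by
    rw [zero_add, leaf, List.getD_eq_getElem _ _ hi]

theorem assocStep_map (g : X → Y) (o : Op) (l r : Mon X) :
    assocStep o (l.map g) (r.map g) = (assocStep o l r).map (map g) := by
  cases o <;> rcases l with x | ⟨_ | _, a, b⟩ <;> rfl

theorem interchangeStep_map (g : X → Y) (o : Op) (l r : Mon X) :
    interchangeStep o (l.map g) (r.map g) = (interchangeStep o l r).map (map g) := by
  cases o <;> rcases l with x | ⟨_ | _, a, b⟩ <;> rcases r with y | ⟨_ | _, c, d⟩ <;> rfl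

theorem steps_map (g : X → Y) (m : Mon X) : (m.map g).steps = m.steps.map (map g) := by
  induction m with
  | var x => rfl
  | mul o l r hl hr =>
    simp [map, steps, hl, hr, assocStep_map, interchangeStep_map, Function.comp_def]

theorem size_of_mem_steps {m n : Mon X} (h : n ∈ m.steps) : n.size = m.size := by
  induction m generalizing n with
  | var x => simp [steps] at h
  | mul o l r hl hr =>
    simp only [steps, List.mem_append, List.mem_map] at h
    rcases h with ⟨l', h, rfl⟩ | ⟨r', h, rfl⟩ | h | h
    · simp [size, hl h]
    · simp [size, hr h]
    · cases o <;> rcases l with x | ⟨_ | _, a, b⟩ <;> simp [assocStep] at h <;> subst h <;>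
        simp [size, add_assoc]
    · cases o <;> rcases l with x | ⟨_ | _, a, b⟩ <;> rcases r with y | ⟨_ | _, c, d⟩ <;>
        simp [interchangeStep] at h
      subst h
      simp only [size]
      omega

theorem expand_map (g : X → Y) (m : Mon X) : (m.map g).expand = m.expand.map (map g) := by
  induction m with
  | var x => rfl
  | mul o l r hl hr =>
    simp [map, expand, hl, hr, List.flatMap_map, List.map_flatMap]

theorem size_of_mem_expand {m n : Mon X} (h : n ∈ m.expand) : n.size = m.size := by
  induction m generalizing n with
  | var x => simp [expand] at h; simp [h]
  | mul o l r hl hr =>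
    simp only [expand, List.mem_flatMap, List.mem_cons, List.not_mem_nil, or_false] at h
    obtain ⟨a, ha, b, hb, rfl | rfl⟩ := h
    · simp [size, hl ha, hr hb]
    · simp [size, hl ha, hr hb, add_comm]

theorem size_orient (m : Mon X) : m.orient.size = m.size := by
  induction m with
  | var x => rfl
  | mul o l r hl hr =>
    simp only [orient, orientedMul]
    cases Nat.ble l.orient.weight r.orient.weight <;> simp [size, hl, hr, add_comm]

theorem weight_relabel (m : Mon X) (k : ℕ) : (m.relabel k).weight = m.weight := by
  rcases m with x | ⟨_ | _, l, r⟩ <;> simp [relabel, weight, size_relabel]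

/-- The factors of every product stand in the order of `orient`. -/
def IsOriented : Mon X → Prop
  | var _ => True
  | mul _ l r => l.IsOriented ∧ r.IsOriented ∧ l.weight ≤ r.weight

theorem isOriented_orient (m : Mon X) : m.orient.IsOriented := by
  induction m with
  | var x => trivial
  | mul o l r hl hr =>
    simp only [orient, orientedMul]
    cases h : Nat.ble l.orient.weight r.orient.weight
    · refine ⟨hr, hl, ?_⟩
      by_contra! h'
      rw [Nat.ble_eq_true_of_le h'.le] at h
      exact Bool.noConfusion h
    · exact ⟨hl, hr, Nat.le_of_ble_eq_true h⟩

/-- Weights depend only on the root operation and the number of leaves, not on the variables. So the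
numbered shape of an oriented monomial is among the shapes that `inverseTest` does not skip. -/
theorem IsOriented.relabel {m : Mon X} (h : m.IsOriented) (k : ℕ) :
    (m.relabel k).IsOriented := by
  induction m generalizing k with
  | var x => trivial
  | mul o l r hl hr =>
    exact ⟨hl h.1 _, hr h.2.1 _, by simpa only [weight_relabel] using h.2.2⟩

theorem IsOriented.orient_eq {m : Mon X} (h : m.IsOriented) : m.orient = m := by
  induction m with
  | var x => rfl
  | mul o l r hl hr =>
    simp only [orient, orientedMul, hl h.1, hr h.2.1, Nat.ble_eq_true_of_le h.2.2, cond_true]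

theorem beq_self (m : Mon ℕ) : m.beq m = true := by
  induction m with
  | var x => simp [beq]
  | mul o l r hl hr => cases o <;> simp [beq, Op.beq, hl, hr]

/-- Completeness of the enumeration. The number of leaves bounds the height, because both factors of
a product have at least one leaf and hence fewer leaves than the product. -/
theorem relabel_mem_shapes (m : Mon X) (d k : ℕ) (hd : m.size ≤ d) :
    m.relabel k ∈ shapes d m.size k := by
  induction m generalizing d k with
  | var x =>
    obtain ⟨d, rfl⟩ : ∃ e, d = e + 1 := ⟨d - 1, by simp [size] at hd; omega⟩
    simp [relabel, shapes, size]
  | mul o l r hl hr =>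
    have h₁ := l.size_pos
    have h₂ := r.size_pos
    simp only [size] at hd
    obtain ⟨d, rfl⟩ : ∃ e, d = e + 1 := ⟨d - 1, by omega⟩
    have hn : Nat.beq (l.size + r.size) 1 = false := by
      rw [Bool.eq_false_iff]
      intro h
      have := Nat.eq_of_beq_eq_true h
      omega
    simp only [relabel, shapes, size, hn, cond_false, List.mem_flatMap]
    refine ⟨l.size, by simp; omega, _, hl d k (by omega), r.relabel (k + l.size), ?_, ?_⟩
    · rw [Nat.add_sub_cancel_left]
      exact hr d _ (by omega)
    · cases o <;> simp

end Mon

theorem Poly.mul_single_single {F : Type*} [Field F] {X : Type*} (o : Op) (m n : Mon X) :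
    Poly.mul F X o (Finsupp.single m 1) (Finsupp.single n 1) =
      Finsupp.single (Mon.mul o m n) 1 := by
  simp [Poly.mul]

/-! ### Values of integral combinations -/

namespace Comb

open Mon

variable {X Y V W : Type*} [AddCommGroup V] [AddCommGroup W]

/-- The value of a combination, given the values of the monomials. -/
def val (v : Mon X → V) (l : Comb X) : V := (l.map fun p => p.1 • v p.2).sum

variable (v : Mon X → V)

@[simp]
theorem val_nil : val v [] = 0 := rfl

@[simp]
theorem val_cons (p : ℤ × Mon X) (l : Comb X) : val v (p :: l) = p.1 • v p.2 + val v l := by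
  simp [val]

@[simp]
theorem val_append (l l' : Comb X) : val v (l ++ l') = val v l + val v l' := by
  simp [val]

@[simp]
theorem val_scale (k : ℤ) (l : Comb X) : val v (l.scale k) = k • val v l := by
  induction l with
  | nil => simp [scale]
  | cons p l h => simp [scale, mul_smul] at h ⊢; rw [h]

@[simp]
theorem val_mapMon (v : Mon Y → V) (g : Mon X → Mon Y) (l : Comb X) :
    val v (l.mapMon g) = val (fun m => v (g m)) l := by
  simp [val, mapMon, Function.comp_def]

theorem val_flatMap {A : Type*} (f : A → Comb X) (l : List A) :
    val v (l.flatMap f) = (l.map fun a => val v (f a)).sum := by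
  induction l with
  | nil => rfl
  | cons a l h => simp [h]

theorem map_val {G : Type*} [FunLike G V W] [AddMonoidHomClass G V W] (f : G) (l : Comb X) :
    f (val v l) = val (fun m => f (v m)) l := by
  induction l with
  | nil => simp
  | cons p l h => simp [h]

theorem mapMon_mapMon {Z : Type*} (h : Mon Y → Mon Z) (g : Mon X → Mon Y) (l : Comb X) :
    (l.mapMon g).mapMon h = l.mapMon fun m => h (g m) := by
  simp [mapMon]

/-- The value of the terms in a search tree. -/
def Tree.val (v : Mon ℕ → V) : Tree → V
  | leaf => 0
  | node s t _ k m => k • v m + (s.val v + t.val v)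

/-- The hash value and the order of the tree play no role for soundness: coefficients are merged
only when `e` holds. A bad hash could make a test fail, but never succeed wrongly. -/
theorem Tree.val_insert {v : Mon ℕ → V} {e : Mon ℕ → Mon ℕ → Bool}
    (he : ∀ m n, e m n = true → v m = v n) (h : ℕ) (k : ℤ) (m : Mon ℕ) (t : Tree) :
    (t.insert e h k m).val v = k • v m + t.val v := by
  induction t with
  | leaf => simp [insert, Tree.val]
  | node s t h' k' m' hs ht =>
    simp only [insert]
    rcases hb : (Nat.beq h h' && e m m') with _ | _
    · cases Nat.ble h h' <;> simp only [cond_false, cond_true, Tree.val, hs, ht] <;> abel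
    · have := he m m' (by simp only [Bool.and_eq_true] at hb; exact hb.2)
      simp only [cond_true, Tree.val, this, add_smul]
      abel

theorem force_eq {A : Type*} (n : ℕ) (f : ℕ → A) : force n f = f n := by
  cases n <;> rfl

theorem val_collect {v : Mon ℕ → V} (h : Mon ℕ → ℕ) {e : Mon ℕ → Mon ℕ → Bool}
    (he : ∀ m n, e m n = true → v m = v n) (l : Comb ℕ) : (l.collect h e).val v = val v l := by
  induction l with
  | nil => rfl
  | cons p l ih => simp only [collect, force_eq, Tree.val_insert he, ih, val_cons]

theorem Tree.val_eq_zero (v : Mon ℕ → V) {t : Tree} (h : t.isZero = true) : t.val v = 0 := by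
  induction t with
  | leaf => rfl
  | node s t h' k m hs ht =>
    simp only [isZero, Bool.and_eq_true, beq_iff_eq] at h
    simp [Tree.val, h.1, hs h.2.1, ht h.2.2]

theorem val_eq_zero (v : Mon ℕ → V) {l : Comb ℕ} (h : l.isZero = true) : val v l = 0 := by
  rw [← val_collect hash (e := Mon.beq) (fun m n hmn => by rw [beq_sound hmn])]
  exact Tree.val_eq_zero v h

theorem val_eq_zero_of_comm {v : Mon ℕ → V} (hv : ∀ m n, CommRel m n → v m = v n)
    {l : Comb ℕ}
    (h : l.isZeroComm = true) : val v l = 0 := by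
  rw [← val_collect hashComm (e := beqComm) (fun m n hmn => hv _ _ (commRel_of_beqComm hmn))]
  exact Tree.val_eq_zero v h

variable (F : Type*) [Field F]

/-- The polynomial given by a combination. -/
noncomputable def toPoly (l : Comb X) : Poly F X := val (fun m => Finsupp.single m 1) l

variable {F}

theorem eval_toPoly {A : Type*} [AddCommGroup A] [Module F A] (op : BilinOps F A) (a : X → A)
    (l : Comb X) : (toPoly F l).eval op a = val (fun m => m.eval (fun o x y => op o x y) a) l := by
  simp [toPoly, map_val, Poly.eval]

theorem rename_toPoly (g : X → Y) (l : Comb X) :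
    Poly.rename g (toPoly F l) = toPoly F (l.mapMon (Mon.map g)) := by
  simp [toPoly, map_val, Poly.rename]

theorem toPoly_append (l l' : Comb X) : toPoly F (l ++ l') = toPoly F l + toPoly F l' := by
  simp [toPoly]

theorem toPoly_scale (k : ℤ) (l : Comb X) : toPoly F (l.scale k) = k • toPoly F l := by
  simp [toPoly]

theorem toPoly_mul (o : Op) (p q : Comb X) :
    toPoly F (mul o p q) = Poly.mul F X o (toPoly F p) (toPoly F q) := by
  have h (a : ℤ × Mon X) (q : Comb X) :
      toPoly F (q.map fun b => (a.1 * b.1, Mon.mul o a.2 b.2)) =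
        a.1 • Poly.mul F X o (Finsupp.single a.2 1) (toPoly F q) := by
    induction q with
    | nil => simp [toPoly]
    | cons b q ih =>
      simp only [toPoly, List.map_cons, val_cons, map_add, smul_add] at ih ⊢
      rw [ih, map_zsmul, mul_smul]
      simp [Poly.mul]
  induction p with
  | nil => simp [toPoly, mul]
  | cons a p ih =>
    have hp : toPoly F (a :: p) = a.1 • Finsupp.single a.2 1 + toPoly F p := by simp [toPoly]
    rw [hp, map_add, LinearMap.add_apply, ← ih, map_zsmul, LinearMap.smul_apply, ← h, ← toPoly_append]
    rfl

theorem subst_toPoly (f : X → Mon Y) (l : Comb X) :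
    Poly.subst (fun x => Finsupp.single (f x) 1) (toPoly F l) =
      toPoly F (l.mapMon (Mon.bind f)) := by
  rw [Poly.subst, eval_toPoly]
  simp only [toPoly, val_mapMon]
  congr 1
  funext m
  induction m with
  | var x => rfl
  | mul o l r hl hr => rw [Mon.eval, hl, hr, Poly.mul_single_single, Mon.bind]

end Comb

end JJ

namespace JJ

variable {F : Type*} [Field F]

/-! ### Substitution and consequences -/

namespace Poly

variable {X Y A : Type*} [AddCommGroup A] [Module F A]

theorem eval_var (op : BilinOps F A) (a : X → A) (x : X) : (var x : Poly F X).eval op a = a x := by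
  simp [eval, var, Mon.eval]

theorem eval_single (op : BilinOps F A) (a : X → A) (m : Mon X) :
    eval op a (Finsupp.single m (1 : F)) = m.eval (fun o x y => op o x y) a := by
  simp [eval]

theorem eval_mul (op : BilinOps F A) (a : X → A) (o : Op) (p q : Poly F X) :
    (mul F X o p q).eval op a = op o (p.eval op a) (q.eval op a) := by
  have h : (mul F X o).compr₂ (eval op a) = (op o).compl₁₂ (eval op a) (eval op a) := by
    ext m m'
    simp [mul, eval, Mon.eval]
  simpa using LinearMap.congr_fun₂ h p q

theorem eval_subst (op : BilinOps F A) (a : Y → A) (φ : X → Poly F Y) (f : Poly F X) :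
    (subst φ f).eval op a = f.eval op fun x => (φ x).eval op a := by
  have h : (eval op a).comp (subst φ) = eval op fun x => (φ x).eval op a := by
    refine Finsupp.lhom_ext' fun m => LinearMap.ext_ring ?_
    simp only [LinearMap.comp_apply, Finsupp.lsingle_apply, subst, eval_single]
    induction m with
    | var x => rfl
    | mul o l r hl hr => simp only [Mon.eval, eval_mul, hl, hr]
  exact LinearMap.congr_fun h f

theorem subst_var (φ : X → Poly F Y) (x : X) : subst φ (var x) = φ x := eval_var _ _ _

theorem subst_mul (φ : X → Poly F Y) (o : Op) (p q : Poly F X) :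
    subst φ (mul F X o p q) = mul F Y o (subst φ p) (subst φ q) := eval_mul _ _ _ _ _

theorem rename_single (g : X → Y) (m : Mon X) :
    rename g (Finsupp.single m (1 : F)) = Finsupp.single (m.map g) 1 := by
  simp [rename]

theorem subst_var_comp (g : X → Y) (f : Poly F X) :
    subst (fun x => var (g x)) f = rename g f := by
  have h : subst (fun x => var (g x)) = rename (F := F) g := by
    refine Finsupp.lhom_ext' fun m => LinearMap.ext_ring ?_
    simp only [LinearMap.comp_apply, Finsupp.lsingle_apply, subst, eval_single, rename_single]
    induction m with
    | var x => rfl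
    | mul o l r hl hr => rw [Mon.eval, hl, hr, mul_single_single, Mon.map]
  rw [h]

end Poly

section Consequences

variable {S S' : ∀ n : ℕ, Set (Poly F (Fin n))} {X Y : Type*}

theorem subst_mem_consequences {n : ℕ} {f : Poly F (Fin n)} (hf : f ∈ S n) (φ : Fin n → Poly F X) :
    Poly.subst φ f ∈ consequences S X :=
  Submodule.mem_sInf.2 fun _ hI => hI.2 ⟨n, f, hf, φ, rfl⟩

theorem mem_consequences {n : ℕ} {f : Poly F (Fin n)} (hf : f ∈ S n) :
    f ∈ consequences S (Fin n) := by
  have h := subst_mem_consequences hf fun i => Poly.var i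
  rw [Poly.subst_var_comp (fun i => i)] at h
  convert h
  refine (LinearMap.congr_fun (?_ : LinearMap.id = Poly.rename fun i : Fin n => i) f)
  refine Finsupp.lhom_ext' fun m => LinearMap.ext_ring ?_
  simp only [LinearMap.comp_apply, Finsupp.lsingle_apply, Poly.rename_single, LinearMap.id_apply]
  exact congrArg (fun m => Finsupp.single m 1) (Mon.map_id m).symm

theorem consequences_le {I : Submodule F (Poly F X)} (hI : IsIdeal (Poly.mul F X) I)
    (h : ∀ n, ∀ f ∈ S n, ∀ φ : Fin n → Poly F X, Poly.subst φ f ∈ I) : consequences S X ≤ I := by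
  refine sInf_le ⟨hI, ?_⟩
  rintro _ ⟨n, f, hf, φ, rfl⟩
  exact h n f hf φ

theorem subst_consequences {f : Poly F X} (hf : f ∈ consequences S X) (φ : X → Poly F Y) :
    Poly.subst φ f ∈ consequences S Y := by
  have h : consequences S X ≤ (consequences S Y).comap (Poly.subst φ) := by
    refine consequences_le (fun o x y hy => ?_) fun n f hf ψ => ?_
    · simp only [Submodule.mem_comap, Poly.subst_mul] at hy ⊢
      exact isIdeal_idealSpan _ _ o _ _ hy
    · rw [Submodule.mem_comap, Poly.subst, Poly.eval_subst]
      exact subst_mem_consequences hf _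
  exact h hf

theorem consequences_le_consequences (h : ∀ n, ∀ f ∈ S n, f ∈ consequences S' (Fin n)) :
    consequences S X ≤ consequences S' X :=
  consequences_le (isIdeal_idealSpan _ _) fun n f hf φ => subst_consequences (h n f hf) φ

/-- The kernel of every evaluation is an ideal. This serves both for the Jordan products in the free
interchange algebra and for the model that separates the new identities from the old ones. -/
theorem isIdentity_of_mem_consequences {A : Type*} [AddCommGroup A] [Module F A]
    {op : BilinOps F A} (h : ∀ n, ∀ f ∈ S n, IsIdentity op f) {f : Poly F X}
    (hf : f ∈ consequences S X) : IsIdentity op f := by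
  intro a
  have : consequences S X ≤ LinearMap.ker (Poly.eval op a) := by
    refine consequences_le (fun o x y hy => ?_) fun n f hf φ => ?_
    · simp only [LinearMap.mem_ker, Poly.eval_mul] at hy ⊢
      simp [hy]
    · rw [LinearMap.mem_ker, Poly.eval_subst]
      exact h n f hf _
  exact this hf

end Consequences

/-! ### Linearizations -/

theorem Mon.count_eq {n : ℕ} (m : Mon (Fin n)) (i : Fin n) :
    m.count i = m.leaves.countP fun j : Fin n => Nat.beq j i := by
  induction m with
  | var x =>
    by_cases h : x = i
    · simp [count, leaves, h]
    · have : Nat.beq x i = false := by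
        rw [Bool.eq_false_iff]
        exact fun h' => h (Fin.ext (Nat.eq_of_beq_eq_true h'))
      simp [count, leaves, h, this]
  | mul o l r hl hr => simp [count, leaves, hl, hr]

theorem Mon.multilinearTest_iff {n : ℕ} (m : Mon (Fin n)) :
    m.multilinearTest = true ↔ m.IsMultilinear := by
  simp only [multilinearTest, List.all_eq_true, IsMultilinear, count_eq]
  exact ⟨fun h i => Nat.eq_of_beq_eq_true (h i (List.mem_finRange i)),
    fun h i _ => by rw [h i]; rfl⟩

namespace Comb

theorem val_ones {X V : Type*} [AddCommGroup V] (v : Mon X → V) (k : ℤ) (l : List (Mon X)) :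
    val v (l.map fun m => (k, m)) = k • (l.map v).sum := by
  induction l with
  | nil => simp
  | cons m l ih => simp [ih]

theorem subst_single_eq {n k : ℕ} (p : Fin n → Fin k) [∀ x, DecidablePred fun i => p i = x]
    (m : Mon (Fin k)) :
    Poly.subst (fun x => ∑ i with p i = x, Poly.var i) (Finsupp.single m (1 : F)) =
      toPoly F ((m.spread p).map fun m => (1, m)) := by
  rw [Poly.subst, Poly.eval_single, toPoly, val_ones, one_smul]
  induction m with
  | var x =>
    have key (l : List (Fin n)) : (l.map fun i => if p i = x then Poly.var i else 0).sum =
        (((l.filter fun i => Nat.beq (p i) x).map Mon.var).map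
          fun m => (Finsupp.single m 1 : Poly F (Fin n))).sum := by
      induction l with
      | nil => rfl
      | cons i l ih =>
        by_cases h : p i = x
        · rw [List.map_cons, List.sum_cons, ih, if_pos h,
            List.filter_cons_of_pos (by simp [h])]
          rfl
        · have : Nat.beq (p i) x = false := by
            rw [Bool.eq_false_iff]
            exact fun h' => h (Fin.ext (Nat.eq_of_beq_eq_true h'))
          simp [h, ih, this]
    rw [Mon.eval, Finset.sum_filter, Fin.sum_univ_def, key]
    rfl
  | mul o l r hl hr =>
    rw [Mon.eval, hl, hr, Mon.spread]
    generalize l.spread p = s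
    generalize r.spread p = t
    have h (m : Mon (Fin n)) : Poly.mul F (Fin n) o (Finsupp.single m 1)
        (t.map fun m => Finsupp.single m 1).sum =
        ((t.map (Mon.mul o m)).map fun m => (Finsupp.single m 1 : Poly F (Fin n))).sum := by
      induction t with
      | nil => simp
      | cons a t ih => simp [ih, Poly.mul_single_single]
    induction s with
    | nil => simp
    | cons a s ih => simp [ih, h]

open Classical in
theorem filter_toPoly {n : ℕ} (k : ℤ) (l : List (Mon (Fin n))) :
    (k • toPoly F (l.map fun m => (1, m))).filter Mon.IsMultilinear =
      toPoly F ((l.filter Mon.multilinearTest).map fun m => (k, m)) := by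
  rw [toPoly, toPoly, val_ones, val_ones, one_smul]
  rw [show ∀ f : Poly F (Fin n), (k • f).filter Mon.IsMultilinear =
    k • f.filter Mon.IsMultilinear from fun f => map_zsmul (Finsupp.filterAddHom _) k f]
  congr 1
  induction l with
  | nil => exact Finsupp.filter_zero _
  | cons m l ih =>
    rw [List.map_cons, List.sum_cons, Finsupp.filter_add, ih]
    by_cases h : m.IsMultilinear
    · rw [Finsupp.filter_single_of_pos _ h, List.filter_cons_of_pos (m.multilinearTest_iff.2 h),
        List.map_cons, List.sum_cons]
    · rw [Finsupp.filter_single_of_neg _ h, zero_add,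
        List.filter_cons_of_neg (by rwa [m.multilinearTest_iff])]

open Classical in
theorem linearize_toPoly {n k : ℕ} (p : Fin n → Fin k) (l : Comb (Fin k)) :
    JJ.linearize p (toPoly F l) = toPoly F (l.linearize p) := by
  rw [JJ.linearize]
  induction l with
  | nil => simpa [toPoly, Comb.linearize] using Finsupp.filter_zero _
  | cons q l ih =>
    have h : toPoly F (q :: l) = q.1 • Finsupp.single q.2 1 + toPoly F l := by simp [toPoly]
    have h' : Comb.linearize p (q :: l) =
      (((q.2.spread p).filter Mon.multilinearTest).map fun m => (q.1, m)) ++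
        Comb.linearize p l := by
      simp [Comb.linearize]
    rw [h, h', toPoly_append, map_add, Finsupp.filter_add, ih, map_zsmul,
      @subst_single_eq F _ n k p (fun _ _ => Classical.propDecidable _), filter_toPoly]

open Classical in
theorem toPoly_linearize_mem {n k : ℕ} (p : Fin n → Fin k) (l : Comb (Fin k)) :
    toPoly F (l.linearize p) ∈ multilinear F n := by
  rw [← linearize_toPoly, multilinear, Finsupp.mem_supported]
  intro m hm
  rw [JJ.linearize, Finset.mem_coe, Finsupp.support_filter, Finset.mem_filter] at hm
  exact hm.2

end Comb

open Mon in
theorem jordanIdentity_eq (o : Op) : jordanIdentity F o = (jordanComb o).toPoly F := by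
  simp [jordanIdentity, jordanComb, Comb.toPoly, Poly.var, Poly.mul_single_single, sub_eq_add_neg]

open Mon in
theorem newJJ4_eq : newJJ4 F = newComb4.toPoly F := by
  simp [newJJ4, newComb4, Comb.toPoly, Poly.var, Poly.mul_single_single, sub_eq_add_neg]

open Mon in
theorem newJJ51_eq : newJJ51 F = (newComb5 .circ).toPoly F := by
  simp [newJJ51, newComb5, Comb.toPoly, Poly.var, Poly.mul_single_single, sub_eq_add_neg]

open Mon in
theorem newJJ52_eq : newJJ52 F = (newComb5 .bullet).toPoly F := by
  simp [newJJ52, newComb5, Comb.toPoly, Poly.var, Poly.mul_single_single, sub_eq_add_neg]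

theorem linearize_jordanIdentity (o : Op) :
    linearize (![0, 0, 0, 1] : Fin 4 → Fin 2) (jordanIdentity F o) = (jordanLin o).toPoly F := by
  rw [jordanIdentity_eq, Comb.linearize_toPoly, jordanLin]

theorem linearize_newJJ4 :
    linearize (fun _ : Fin 4 => (0 : Fin 1)) (newJJ4 F) = newLin4.toPoly F := by
  rw [newJJ4_eq, Comb.linearize_toPoly, newLin4]

variable (F) in
/-- The linearizations of `newJJ51` and `newJJ52`. -/
noncomputable def linJJ5 : Op → Poly F (Fin 5)
  | .circ => linJJ51 F
  | .bullet => linJJ52 F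

theorem linJJ5_eq (o : Op) : linJJ5 F o = (newLin5 o).toPoly F := by
  cases o
  · rw [linJJ5, linJJ51, newJJ51_eq, Comb.linearize_toPoly, newLin5]
  · rw [linJJ5, linJJ52, newJJ52_eq, Comb.linearize_toPoly, newLin5]

/-! ### Verification of the identities -/

namespace Mon

variable {X A : Type*}

/-- The product for the associative operation `p`, bracketed to the right. -/
def append (p : Op) : Mon X → Mon X → Mon X
  | var x, r => mul p (var x) r
  | mul q a b, r => bif p.beq q then mul p a (append p b r) else mul p (mul q a b) r

/-- The product with the operation `p`, transformed by the interchange identity if `p = o`. -/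
def appendInterchange (o p : Op) : Mon X → Mon X → Mon X
  | mul q a b, mul q' c d =>
    bif o.beq p && (o.other.beq q && o.other.beq q') then
      append o.other (append o a c) (append o b d)
    else append p (mul q a b) (mul q' c d)
  | l, r => append p l r

/-- A monomial which is equal to the given one in associative interchange algebras. -/
def normalForm (o : Op) : Mon X → Mon X
  | var x => var x
  | mul p l r => appendInterchange o p (l.normalForm o) (r.normalForm o)

theorem eval_append {op : Op → A → A → A} (hop : ∀ o x y z, op o (op o x y) z = op o x (op o y z))
    (a : X → A) (p : Op) (l r : Mon X) :
    (append p l r).eval op a = op p (l.eval op a) (r.eval op a) := by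
  induction l with
  | var x => rfl
  | mul q b c _ hc =>
    rw [append]
    cases h : p.beq q
    · rfl
    · cases Op.eq_of_beq h
      simp only [cond_true, eval, hc, hop]

/-- Only equality of values is needed; normal forms are not claimed to be unique. The parameter `o`
fixes the direction in which interchange is applied, and it is chosen for each identity so that its
expansion cancels. -/
theorem eval_normalForm {op : Op → A → A → A}
    (hop : ∀ o x y z, op o (op o x y) z = op o x (op o y z))
    (hint : ∀ x y z w, op .bullet (op .circ x y) (op .circ z w) =
      op .circ (op .bullet x z) (op .bullet y w))
    (a : X → A) (o : Op) (m : Mon X) : (m.normalForm o).eval op a = m.eval op a := by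
  induction m with
  | var x => rfl
  | mul p l r hl hr =>
    rw [normalForm, eval, ← hl, ← hr]
    rcases l.normalForm o with x | ⟨q, b, c⟩ <;> rcases r.normalForm o with y | ⟨q', d, e⟩
    · exact eval_append hop ..
    · exact eval_append hop ..
    · exact eval_append hop ..
    · rw [appendInterchange]
      cases h : o.beq p && (o.other.beq q && o.other.beq q')
      · exact eval_append hop ..
      · simp only [Bool.and_eq_true] at h
        cases Op.eq_of_beq h.1
        cases Op.eq_of_beq h.2.1
        cases Op.eq_of_beq h.2.2
        simp only [cond_true, eval_append hop, eval]
        cases o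
        · exact hint ..
        · exact (hint ..).symm

end Mon

namespace Comb

/-- The expansion of a combination of monomials in the Jordan products, in normal form. -/
def normalExpansion (o : Op) (l : Comb ℕ) : Comb ℕ :=
  l.flatMap fun p => (p.2.expand.map (Mon.normalForm o)).map fun m => (p.1, m)

end Comb

theorem eval_jordan {X A : Type*} [AddCommGroup A] [Module F A] (op : BilinOps F A) (a : X → A)
    (m : Mon X) : m.eval (fun o x y => jordan op o x y) a =
      (m.expand.map fun t => t.eval (fun o x y => op o x y) a).sum := by
  induction m with
  | var x => simp [Mon.eval, Mon.expand]
  | mul o l r hl hr =>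
    rw [Mon.eval, hl, hr, Mon.expand]
    generalize l.expand = s
    generalize r.expand = t
    have h (u : Mon X) : jordan op o (u.eval (fun o x y => op o x y) a)
        (t.map fun t => t.eval (fun o x y => op o x y) a).sum =
        ((t.flatMap fun b => [Mon.mul o u b, Mon.mul o b u]).map
          fun t => t.eval (fun o x y => op o x y) a).sum := by
      induction t with
      | nil => simp
      | cons b t ih =>
        rw [List.map_cons, List.sum_cons, map_add, ih]
        simp [jordan, Mon.eval, add_assoc]
    induction s with
    | nil => simp
    | cons b s ih => simp [ih, h]

theorem isIdentity_of_normalExpansion {A : Type*} [AddCommGroup A] [Module F A] {op : BilinOps F A}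
    (hop : ∀ o x y z, op o (op o x y) z = op o x (op o y z))
    (hint : ∀ x y z w, op .bullet (op .circ x y) (op .circ z w) =
      op .circ (op .bullet x z) (op .bullet y w))
    {n : ℕ} (o : Op) (l : Comb (Fin n)) (h : (l.toNat.normalExpansion o).isZero = true) :
    IsIdentity (jordan op) (l.toPoly F) := by
  intro a
  -- The test works with variables in ℕ, which `Fin.ofNat n` sends back to `Fin n`. This needs n ≠
  -- 0, and any monomial of a nonempty combination supplies a variable.
  have hn : 0 < n ∨ l = [] := by
    rcases l with _ | ⟨p, l⟩
    · exact .inr rfl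
    · exact .inl (Fin.pos p.2.first)
  rcases hn with hn | rfl
  swap
  · simp [Comb.toPoly]
  have : NeZero n := ⟨hn.ne'⟩
  have key := Comb.val_eq_zero
    (fun m : Mon ℕ => m.eval (fun o x y => op o x y) fun i => a (Fin.ofNat n i)) h
  rw [Comb.eval_toPoly, ← key, Comb.normalExpansion, Comb.val_flatMap, Comb.toNat, Comb.mapMon,
    List.map_map, Comb.val]
  congr 1
  refine List.map_congr_left fun p _ => ?_
  simp only [Function.comp_apply, Comb.val_ones, Mon.expand_map, eval_jordan]
  rw [List.map_map, List.map_map]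
  congr 2
  refine List.map_congr_left fun m _ => ?_
  simp only [Function.comp_apply]
  rw [Mon.eval_normalForm (op := fun o x y => op o x y) hop hint, Mon.eval_map]
  congr 1
  funext i
  simp

theorem FreeAI.op_mk {X : Type*} (o : Op) (x y : Poly F X) :
    FreeAI.op F X o ((interchangeIdeal F X).mkQ x) ((interchangeIdeal F X).mkQ y) =
      (interchangeIdeal F X).mkQ (Poly.mul F X o x y) := rfl

theorem FreeAI.op_assoc {X : Type*} (o : Op) (x y z : FreeAI F X) :
    FreeAI.op F X o (FreeAI.op F X o x y) z = FreeAI.op F X o x (FreeAI.op F X o y z) := by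
  obtain ⟨x, rfl⟩ := Submodule.mkQ_surjective _ x
  obtain ⟨y, rfl⟩ := Submodule.mkQ_surjective _ y
  obtain ⟨z, rfl⟩ := Submodule.mkQ_surjective _ z
  simp only [op_mk]
  refine (Submodule.Quotient.eq _).2 ?_
  have h := subst_mem_consequences (X := X) (S := fun n => {f | AssocInterchange F n f})
    (AssocInterchange.assoc o) ![x, y, z]
  simp only [map_sub, Poly.subst_mul, Poly.subst_var] at h
  exact h

theorem FreeAI.op_interchange {X : Type*} (x y z w : FreeAI F X) :
    FreeAI.op F X .bullet (FreeAI.op F X .circ x y) (FreeAI.op F X .circ z w) =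
      FreeAI.op F X .circ (FreeAI.op F X .bullet x z) (FreeAI.op F X .bullet y w) := by
  obtain ⟨x, rfl⟩ := Submodule.mkQ_surjective _ x
  obtain ⟨y, rfl⟩ := Submodule.mkQ_surjective _ y
  obtain ⟨z, rfl⟩ := Submodule.mkQ_surjective _ z
  obtain ⟨w, rfl⟩ := Submodule.mkQ_surjective _ w
  simp only [op_mk]
  refine (Submodule.Quotient.eq _).2 ?_
  have h := subst_mem_consequences (X := X) (S := fun n => {f | AssocInterchange F n f})
    AssocInterchange.interchange ![x, y, z, w]
  simp only [map_sub, Poly.subst_mul, Poly.subst_var] at h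
  exact h

theorem isIdentity_of_isZero {n : ℕ} (o : Op) (l : Comb (Fin n))
    (h : (l.toNat.normalExpansion o).isZero = true) :
    IsIdentity (jordan (FreeAI.op F ℕ)) (l.toPoly F) :=
  isIdentity_of_normalExpansion FreeAI.op_assoc FreeAI.op_interchange o l h

theorem linJJ5_mem (o : Op) : linJJ5 F o ∈ allIdentities F 5 := by
  rw [linJJ5_eq]
  refine ⟨Comb.toPoly_linearize_mem _ _, isIdentity_of_isZero o _ ?_⟩
  cases o <;> decide +kernel

theorem lowerList_mem {n : ℕ} {f : Poly F (Fin n)} (h : LowerList F n f) :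
    f ∈ allIdentities F n := by
  cases h with
  | comm o =>
    constructor
    · have h (s : Fin 2 → Fin 2) (hs : ∀ i, (if s 0 = i then 1 else 0) +
          (if s 1 = i then 1 else 0) = 1) :
          Poly.mul F (Fin 2) o (Poly.var (s 0)) (Poly.var (s 1)) ∈ multilinear F 2 := by
        rw [Poly.var, Poly.var, Poly.mul_single_single]
        refine Finsupp.single_mem_supported _ _ fun i => ?_
        rw [Mon.count, Mon.count, Mon.count]
        convert hs i
      exact sub_mem (h id (by decide)) (h ![1, 0] (by decide))
    · intro a
      simp [commutativity, Poly.eval_mul, Poly.eval_var, jordan, add_comm]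
  | jordan o =>
    rw [linearize_jordanIdentity]
    refine ⟨Comb.toPoly_linearize_mem _ _, isIdentity_of_isZero o _ ?_⟩
    cases o <;> decide +kernel
  | new4 =>
    rw [linearize_newJJ4]
    exact ⟨Comb.toPoly_linearize_mem _ _, isIdentity_of_isZero .circ _ (by decide +kernel)⟩

end JJ

namespace JJ

variable {F : Type*} [Field F] {X Y : Type*}

/-! ### Consequences of the identities of degree at most four -/

variable (F X) in
/-- The consequences of commutativity, the Jordan identities and `newJJ4`. -/
noncomputable abbrev lowerConsequences : Submodule F (Poly F X) :=
  consequences (fun n => {g | LowerList F n g}) X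

theorem isIdeal_lowerConsequences : IsIdeal (Poly.mul F X) (lowerConsequences F X) :=
  isIdeal_idealSpan _ _

theorem sub_comm_mem (o : Op) (p q : Poly F X) :
    Poly.mul F X o p q - Poly.mul F X o q p ∈ lowerConsequences F X := by
  have h := subst_mem_consequences (S := fun n => {g | LowerList F n g}) (LowerList.comm o) ![p, q]
  simp only [commutativity, map_sub, Poly.subst_mul, Poly.subst_var] at h
  exact h

theorem mul_sub_mul_mem (o : Op) {p p' q q' : Poly F X} (hp : p - p' ∈ lowerConsequences F X)
    (hq : q - q' ∈ lowerConsequences F X) :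
    Poly.mul F X o p q - Poly.mul F X o p' q' ∈ lowerConsequences F X := by
  have h₁ := (isIdeal_lowerConsequences o q _ hp).2
  have h₂ := (isIdeal_lowerConsequences o p' _ hq).1
  have h := add_mem h₁ h₂
  rwa [map_sub, LinearMap.sub_apply, map_sub, sub_add_sub_cancel] at h

theorem single_sub_single_mem {m n : Mon X} (h : Mon.CommRel m n) :
    Finsupp.single m 1 - Finsupp.single n 1 ∈ lowerConsequences F X := by
  induction h with
  | refl m => simp
  | mul o _ _ hl hr =>
    rw [← Poly.mul_single_single, ← Poly.mul_single_single]
    exact mul_sub_mul_mem o hl hr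
  | @comm o l r _ _ _ _ hl hr =>
    rw [← Poly.mul_single_single, ← Poly.mul_single_single]
    have h := add_mem (sub_comm_mem o (Finsupp.single l 1) (Finsupp.single r 1))
      (mul_sub_mul_mem o hr hl)
    rwa [sub_add_sub_cancel] at h

/-- Modulo `lowerConsequences` the class of a monomial depends only on its class under
commutativity, so a cancellation modulo commutativity proves membership. -/
theorem toPoly_mem_of_isZeroComm (g : ℕ → X) {l : Comb ℕ} (h : l.isZeroComm = true) :
    (l.mapMon (Mon.map g)).toPoly F ∈ lowerConsequences F X := by
  have h := Comb.val_eq_zero_of_comm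
    (v := fun m => (lowerConsequences F X).mkQ (Finsupp.single (m.map g) 1)) (fun m n hmn =>
      (Submodule.Quotient.eq _).2 (single_sub_single_mem (hmn.map g))) h
  rw [← Comb.map_val] at h
  rw [Comb.toPoly, Comb.val_mapMon]
  exact (Submodule.Quotient.mk_eq_zero _).1 h

theorem mem_of_zsmul_mem [CharZero F] {V : Type*} [AddCommGroup V] [Module F V]
    {T : Submodule F V} {k : ℤ} (hk : k ≠ 0) {x : V} (h : k • x ∈ T) : x ∈ T := by
  rw [← Int.cast_smul_eq_zsmul F] at h
  exact (T.smul_mem_iff (Int.cast_ne_zero.2 hk)).1 h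

theorem toPoly_mem_of_multiple [CharZero F] {n : ℕ} {l : Comb (Fin n)} {l' : Comb ℕ} {k : ℤ}
    (hk : k ≠ 0) (hl : l.toPoly F ∈ lowerConsequences F (Fin n))
    (h : Comb.isZeroComm (l.toNat ++ l'.scale (-k)) = true) :
    l'.toPoly F ∈ lowerConsequences F ℕ := by
  have h₁ := toPoly_mem_of_isZeroComm (F := F) id h
  have h₂ : ∀ l : Comb ℕ, l.mapMon (Mon.map id) = l := fun l => by
    simp [Comb.mapMon, Mon.map_id]
  rw [h₂, Comb.toPoly_append, Comb.toPoly_scale, Comb.toNat, ← Comb.rename_toPoly] at h₁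
  have h₃ := sub_mem (rename_mem_consequences _ Fin.val hl) h₁
  refine mem_of_zsmul_mem hk ?_
  convert h₃ using 1
  simp

/-! ### The relations that occur in the certificates -/

section Relations

variable [CharZero F]

theorem jordanTerms_mem (o : Op) :
    (jordanTerms o (.var 0) (.var 1) (.var 2) (.var 3)).toPoly F ∈ lowerConsequences F ℕ := by
  -- The six orders of the three copies of a give each of the three terms on either side twice, by
  -- the symmetry of {a, a}.
  refine toPoly_mem_of_multiple (k := 2) two_ne_zero (l := jordanLin o) ?_ ?_
  · rw [← linearize_jordanIdentity]
    exact mem_consequences (S := fun n => {g | LowerList F n g}) (LowerList.jordan o)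
  · cases o <;> decide +kernel

theorem newTerms4_mem :
    (newTerms4 (.var 0) (.var 1) (.var 2) (.var 3)).toPoly F ∈ lowerConsequences F ℕ := by
  -- Each side has 24 orders of the four copies of a and only three terms up to commutativity, one
  -- for each splitting into two pairs.
  refine toPoly_mem_of_multiple (k := 8) (by norm_num) (l := newLin4) ?_ (by decide +kernel)
  rw [← linearize_newJJ4]
  exact mem_consequences (S := fun n => {g | LowerList F n g}) LowerList.new4

theorem Rel.comb_mem (r : Rel) (g : ℕ → X) :
    (r.comb.mapMon (Mon.map g)).toPoly F ∈ lowerConsequences F X := by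
  have key (x y z w : Mon ℕ) {l : Comb ℕ} (h : l.toPoly F ∈ lowerConsequences F ℕ) :=
    subst_consequences h fun i => Finsupp.single (([x, y, z, w].getD i x).map g) 1
  induction r with
  | jordan o x y z w =>
    have h := key x y z w (jordanTerms_mem o)
    rwa [Comb.subst_toPoly] at h
  | interchange x y z w =>
    have h := key x y z w newTerms4_mem
    rwa [Comb.subst_toPoly] at h
  | under o x r ih =>
    rw [Rel.comb, ← Comb.rename_toPoly, Comb.toPoly_mul, Poly.rename_mul, Comb.rename_toPoly,
      Comb.rename_toPoly]
    exact (isIdeal_lowerConsequences o _ _ ih).1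

end Relations

/-! ### Symmetrization -/

/-- `symmetrize` looks only at the shape of a monomial and puts the leaves back at the end. -/
theorem symmetrize_map (n : ℕ) (g : X → Y) (m : Mon X) :
    symmetrize n (m.map g) = (symmetrize n m).mapMon (Mon.map g) := by
  rw [symmetrize, symmetrize, Comb.mapMon_mapMon, Mon.relabel_map]
  simp only [Mon.map_map]
  congr 2
  funext i
  exact Mon.leaf_map g m i

theorem symmetrize_sub_mem {n : ℕ} (hn : invarianceTest n = true) {m m' : Mon X}
    (hm : m.size = n) (h : m' ∈ m.steps) :
    (symmetrize n m).toPoly F - (symmetrize n m').toPoly F ∈ lowerConsequences F X := by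
  have hs := Mon.relabel_mem_shapes m n 0 hm.le
  rw [hm] at hs
  obtain ⟨s', hs', rfl⟩ : ∃ s' ∈ (m.relabel 0).steps, s'.map m.leaf = m' := by
    rw [← m.map_relabel, Mon.steps_map] at h
    simpa using h
  have h₁ := List.all_eq_true.1 (List.all_eq_true.1 hn _ hs) _ hs'
  have h₂ := toPoly_mem_of_isZeroComm (F := F) m.leaf h₁
  rw [← Comb.rename_toPoly, Comb.toPoly_append, Comb.toPoly_scale, map_add, map_zsmul,
    Comb.rename_toPoly, Comb.rename_toPoly, ← symmetrize_map, ← symmetrize_map,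
    m.map_relabel] at h₂
  convert h₂ using 1
  simp [sub_eq_add_neg]

/-- Both laws are multilinear, so substitutions of polynomials reduce to substitutions of monomials.
The span is an ideal because a step inside one factor is a step of the product. One direction of
each law suffices, since a span contains negatives. -/
theorem interchangeIdeal_le : interchangeIdeal F X ≤ Submodule.span F
    {f | ∃ m : Mon X, ∃ m' ∈ m.steps, f = Finsupp.single m (1 : F) - Finsupp.single m' 1} := by
  set I := Submodule.span F
    {f | ∃ m : Mon X, ∃ m' ∈ m.steps, f = Finsupp.single m (1 : F) - Finsupp.single m' 1} with hI
  refine consequences_le (fun o x y hy => ?_) fun n f hf φ => ?_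
  · induction hy using Submodule.span_induction with
    | zero => simp
    | add y z _ _ hy hz =>
      simp only [map_add, LinearMap.add_apply]
      exact ⟨add_mem hy.1 hz.1, add_mem hy.2 hz.2⟩
    | smul c y _ hy =>
      simp only [map_smul, LinearMap.smul_apply]
      exact ⟨I.smul_mem c hy.1, I.smul_mem c hy.2⟩
    | mem y hy =>
      obtain ⟨m, m', h, rfl⟩ := hy
      induction x using Finsupp.induction_linear with
      | zero => simp
      | add x z hx hz =>
        simp only [map_add, LinearMap.add_apply]
        exact ⟨add_mem hx.1 hz.1, add_mem hx.2 hz.2⟩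
      | single u c =>
        rw [← mul_one c, ← smul_eq_mul, ← Finsupp.smul_single]
        simp only [map_smul, LinearMap.smul_apply, map_sub, LinearMap.sub_apply,
          Poly.mul_single_single, ← smul_sub]
        refine ⟨I.smul_mem c (Submodule.subset_span ⟨_, Mon.mul o u m', ?_, rfl⟩),
          I.smul_mem c (Submodule.subset_span ⟨_, Mon.mul o m' u, ?_, rfl⟩)⟩
        · simp [Mon.steps, h]
        · simp [Mon.steps, h]
  · cases hf with
    | assoc o =>
      simp only [map_sub, Poly.subst_mul, Poly.subst_var]
      generalize φ 0 = x, φ 1 = y, φ 2 = z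
      induction x using Finsupp.induction_linear with
      | zero => simp
      | add x x' hx hx' =>
        simp only [map_add, LinearMap.add_apply]
        convert add_mem hx hx' using 1
        abel
      | single u c =>
      induction y using Finsupp.induction_linear with
      | zero => simp
      | add x x' hx hx' =>
        simp only [map_add, LinearMap.add_apply]
        convert add_mem hx hx' using 1
        abel
      | single v d =>
      induction z using Finsupp.induction_linear with
      | zero => simp
      | add x x' hx hx' =>
        simp only [map_add]
        convert add_mem hx hx' using 1
        abel
      | single w e =>
        rw [← mul_one c, ← mul_one d, ← mul_one e]
        simp only [← smul_eq_mul, ← Finsupp.smul_single]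
        simp only [map_smul, LinearMap.smul_apply, Poly.mul_single_single]
        simp only [← smul_sub]
        refine I.smul_mem _ (I.smul_mem _ (I.smul_mem _ (Submodule.subset_span ⟨_, _, ?_, rfl⟩)))
        cases o <;> simp [Mon.steps, Mon.assocStep]
    | interchange =>
      simp only [map_sub, Poly.subst_mul, Poly.subst_var]
      generalize φ 0 = x, φ 1 = y, φ 2 = z, φ 3 = t
      induction x using Finsupp.induction_linear with
      | zero => simp
      | add x x' hx hx' =>
        simp only [map_add, LinearMap.add_apply]
        convert add_mem hx hx' using 1
        abel
      | single u c =>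
      induction y using Finsupp.induction_linear with
      | zero => simp
      | add x x' hx hx' =>
        simp only [map_add, LinearMap.add_apply]
        convert add_mem hx hx' using 1
        abel
      | single v d =>
      induction z using Finsupp.induction_linear with
      | zero => simp
      | add x x' hx hx' =>
        simp only [map_add, LinearMap.add_apply]
        convert add_mem hx hx' using 1
        abel
      | single w e =>
      induction t using Finsupp.induction_linear with
      | zero => simp
      | add x x' hx hx' =>
        simp only [map_add]
        convert add_mem hx hx' using 1
        abel
      | single r s =>
        rw [← mul_one c, ← mul_one d, ← mul_one e, ← mul_one s]
        simp only [← smul_eq_mul, ← Finsupp.smul_single]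
        simp only [map_smul, LinearMap.smul_apply, Poly.mul_single_single]
        -- Interchange exchanges the two middle arguments, so their scalars come out in different
        -- orders on the two sides.
        rw [smul_comm d e]
        simp only [← smul_sub]
        refine I.smul_mem _ (I.smul_mem _ (I.smul_mem _ (I.smul_mem _
          (Submodule.subset_span ⟨_, _, ?_, rfl⟩))))
        simp [Mon.steps, Mon.interchangeStep]

variable (F X) in
/-- The linear extension of `symmetrize` in degree `n`. -/
noncomputable def symmetrizeMap (n : ℕ) : Poly F X →ₗ[F] Poly F X :=
  Finsupp.linearCombination F fun m => if m.size = n then (symmetrize n m).toPoly F else 0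

theorem symmetrizeMap_single {n : ℕ} {m : Mon X} (hm : m.size = n) :
    symmetrizeMap F X n (Finsupp.single m 1) = (symmetrize n m).toPoly F := by
  simp [symmetrizeMap, hm]

/-- A step preserves the number of leaves. So either both terms of a generator have degree `n` and
the test applies, or both are sent to zero. -/
theorem symmetrizeMap_mem {n : ℕ} (hn : invarianceTest n = true) {f : Poly F X}
    (hf : f ∈ interchangeIdeal F X) : symmetrizeMap F X n f ∈ lowerConsequences F X := by
  have h : interchangeIdeal F X ≤ (lowerConsequences F X).comap (symmetrizeMap F X n) := by
    refine interchangeIdeal_le.trans (Submodule.span_le.2 ?_)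
    rintro _ ⟨m, m', h, rfl⟩
    have hs := Mon.size_of_mem_steps h
    rw [SetLike.mem_coe, Submodule.mem_comap, map_sub]
    by_cases hm : m.size = n
    · rw [symmetrizeMap_single hm, symmetrizeMap_single (hs.trans hm)]
      exact symmetrize_sub_mem hn hm h
    · simp [symmetrizeMap, hs, hm]
  exact h hf

/-! ### Expansion, and symmetrization as its left inverse up to a factor -/

variable (F X) in
/-- The expansion of the Jordan products. -/
noncomputable def expandMap : Poly F X →ₗ[F] Poly F X :=
  Poly.eval (jordan (Poly.mul F X)) Poly.var

theorem map_eval_jordan {A B : Type*} [AddCommGroup A] [Module F A] [AddCommGroup B] [Module F B]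
    {op : BilinOps F A} {op' : BilinOps F B} (h : A →ₗ[F] B)
    (hh : ∀ o x y, h (op o x y) = op' o (h x) (h y)) (a : X → A) (f : Poly F X) :
    h (f.eval (jordan op) a) = f.eval (jordan op') fun x => h (a x) := by
  have : h.comp (Poly.eval (jordan op) a) = Poly.eval (jordan op') fun x => h (a x) := by
    refine Finsupp.lhom_ext' fun m => LinearMap.ext_ring ?_
    simp only [LinearMap.comp_apply, Finsupp.lsingle_apply, Poly.eval_single]
    induction m with
    | var x => rfl
    | mul o l r hl hr =>
      rw [Mon.eval, Mon.eval, ← hl, ← hr]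
      simp [jordan, hh]
  exact LinearMap.congr_fun this f

/-- Evaluation at the classes of the first n generators shows that the expansion, with variables in
ℕ, lies in the interchange ideal. Renaming along `Fin.ofNat n` returns to `Fin n` and fixes the
variables that occur. -/
theorem expandMap_mem {n : ℕ} [NeZero n] {f : Poly F (Fin n)}
    (hf : IsIdentity (jordan (FreeAI.op F ℕ)) f) :
    expandMap F (Fin n) f ∈ interchangeIdeal F (Fin n) := by
  have h := hf fun i => (interchangeIdeal F ℕ).mkQ (Poly.var (i : ℕ))
  rw [← map_eval_jordan (op := Poly.mul F ℕ) _ (fun _ _ _ => rfl)] at h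
  have h' := rename_mem_consequences _ (Fin.ofNat n) ((Submodule.Quotient.mk_eq_zero _).1 h)
  rw [map_eval_jordan _ (Poly.rename_mul (F := F) (Fin.ofNat n))] at h'
  have hv : (fun i : Fin n => Poly.rename (Fin.ofNat n) (Poly.var (i : ℕ) : Poly F ℕ)) =
      Poly.var := by
    funext i
    simp [Poly.var, Poly.rename_single, Mon.map]
  rwa [hv] at h'

theorem expandMap_single (m : Mon X) : expandMap F X (Finsupp.single m 1) =
    (m.expand.map fun t => (Finsupp.single t 1 : Poly F X)).sum := by
  rw [expandMap, Poly.eval_single, eval_jordan]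
  congr 2
  funext t
  induction t with
  | var x => rfl
  | mul o l r hl hr => rw [Mon.eval, hl, hr, Poly.mul_single_single]

theorem expandMap_eq_of_commRel {m n : Mon X} (h : Mon.CommRel m n) :
    expandMap F X (Finsupp.single m 1) = expandMap F X (Finsupp.single n 1) := by
  simp only [expandMap, Poly.eval_single]
  induction h with
  | refl m => rfl
  | mul o _ _ hl hr => rw [Mon.eval, Mon.eval, hl, hr]
  | comm o _ _ hl hr => rw [Mon.eval, Mon.eval, hl, hr]; simp [jordan, add_comm]

/-- Statement (b) for a single monomial. The factors may be put into the order of `orient` first: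
this leaves the expansion unchanged and alters the monomial only within `lowerConsequences`. For the
oriented monomial the test exhibits the difference as minus a combination of certified relations, up
to commutativity; `hH` supplies those of them that are not consequences of lower degree. -/
theorem factor_smul_sub_mem [CharZero F] {n : ℕ} (hn : inverseTest n = true) {m : Mon X}
    (hm : m.size = n) {T : Submodule F (Poly F X)} (hT : lowerConsequences F X ≤ T)
    (hH : ∀ p ∈ hooksOf (m.orient.relabel 0),
      ((hook p.2.1 p.2.2).mapMon (Mon.map m.orient.leaf)).toPoly F ∈ T) :
    Symmetrize.factor n • Finsupp.single m (1 : F) -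
      symmetrizeMap F X n (expandMap F X (Finsupp.single m 1)) ∈ T := by
  have hc := Mon.commRel_orient m
  rw [← expandMap_eq_of_commRel hc]
  have hN := T.smul_of_tower_mem (Symmetrize.factor n) (hT (single_sub_single_mem (F := F) hc))
  rw [smul_sub] at hN
  have hm' := m.size_orient.trans hm
  have ho := m.isOriented_orient
  generalize m.orient = m' at *
  have hs := Mon.relabel_mem_shapes m' n 0 hm'.le
  rw [hm'] at hs
  have h₁ := List.all_eq_true.1 hn _ hs
  rw [(ho.relabel 0).orient_eq, Mon.beq_self, Bool.not_true, Bool.false_or] at h₁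
  have h₂ := hT (toPoly_mem_of_isZeroComm (F := F) m'.leaf h₁)
  have h₃ : ((certificate (m'.relabel 0)).mapMon (Mon.map m'.leaf)).toPoly F ∈ T := by
    rw [certificate, ← Comb.rename_toPoly, Comb.toPoly_append, map_add]
    have key {A : Type} (l : List A) (f : A → Comb ℕ)
        (h : ∀ a ∈ l, Poly.rename m'.leaf ((f a).toPoly F) ∈ T) :
        Poly.rename m'.leaf (Comb.toPoly F (l.flatMap f)) ∈ T := by
      induction l with
      | nil => simp [Comb.toPoly]
      | cons a l ih =>
        rw [List.flatMap_cons, Comb.toPoly_append, map_add]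
        exact add_mem (h a (by simp)) (ih fun b hb => h b (by simp [hb]))
    refine add_mem (key _ _ fun p _ => ?_) (key _ _ fun p hp => ?_)
    · rw [Comb.toPoly_scale, map_zsmul, Comb.rename_toPoly]
      exact T.smul_of_tower_mem _ (hT (p.2.comb_mem _))
    · rw [Comb.toPoly_scale, map_zsmul, Comb.rename_toPoly]
      exact T.smul_of_tower_mem _ (hH p hp)
  have h₄ : (Comb.mapMon (Mon.map m'.leaf) ((m'.relabel 0).expand.flatMap (symmetrize n) ++
      ((-Symmetrize.factor n, m'.relabel 0) :: certificate (m'.relabel 0)))).toPoly F =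
      symmetrizeMap F X n (expandMap F X (Finsupp.single m' 1)) -
        Symmetrize.factor n • Finsupp.single m' 1 +
        ((certificate (m'.relabel 0)).mapMon (Mon.map m'.leaf)).toPoly F := by
    have h₅ : Comb.toPoly F (Comb.mapMon (Mon.map m'.leaf)
        ((m'.relabel 0).expand.flatMap (symmetrize n))) =
        symmetrizeMap F X n (expandMap F X (Finsupp.single m' 1)) := by
      conv_rhs => rw [← m'.map_relabel]
      rw [expandMap_single, Mon.expand_map, map_list_sum, List.map_map, List.map_map, Comb.toPoly,
        Comb.val_mapMon, Comb.val_flatMap]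
      congr 1
      refine List.map_congr_left fun t ht => ?_
      have hts : t.size = n := by
        rw [Mon.size_of_mem_expand ht, Mon.size_relabel, hm']
      rw [Function.comp_apply, Function.comp_apply,
        symmetrizeMap_single ((Mon.size_map _ _).trans hts), symmetrize_map, Comb.toPoly,
        Comb.val_mapMon]
    have h₆ : Comb.mapMon (Mon.map m'.leaf)
        ((-Symmetrize.factor n, m'.relabel 0) :: certificate (m'.relabel 0)) =
        (-Symmetrize.factor n, m') :: (certificate (m'.relabel 0)).mapMon (Mon.map m'.leaf) := by
      simp [Comb.mapMon, m'.map_relabel]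
    have h₇ (l l' : Comb ℕ) : Comb.mapMon (Mon.map m'.leaf) (l ++ l') =
        l.mapMon (Mon.map m'.leaf) ++ l'.mapMon (Mon.map m'.leaf) := by simp [Comb.mapMon]
    rw [h₇, Comb.toPoly_append, h₅, h₆]
    simp only [Comb.toPoly, Comb.val_cons, neg_smul]
    abel
  rw [h₄] at h₂
  -- With S∘E for symmetrization after expansion and C for the certificate, this is C - (S(E(m')) -
  -- N m' + C) - (N m' - N m) = N m - S(E(m')).
  have h₅ := sub_mem (sub_mem h₃ h₂) hN
  convert h₅ using 1
  abel

/-! ### The identities of degree at most five -/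

theorem Mon.sum_count {n : ℕ} (m : Mon (Fin n)) : ∑ i, m.count i = m.size := by
  induction m with
  | var x =>
    simp only [count, size]
    refine (Finset.sum_eq_single x (fun i _ hi => if_neg hi.symm) fun h => ?_).trans (if_pos rfl)
    exact absurd (Finset.mem_univ x) h
  | mul o l r hl hr => simp [count, size, Finset.sum_add_distrib, hl, hr]

theorem Mon.IsMultilinear.size_eq {n : ℕ} {m : Mon (Fin n)} (h : m.IsMultilinear) :
    m.size = n := by
  rw [← m.sum_count, Finset.sum_congr rfl fun i _ => h i]
  simp

theorem Mon.CommRel.count_eq {m n : Mon X} (h : CommRel m n) (x : X) : m.count x = n.count x := by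
  induction h with
  | refl m => rfl
  | mul o _ _ hl hr => simp [count, hl, hr]
  | comm o _ _ hl hr => simp [count, hl, hr, add_comm]

/-- For an identity f the element N f - S(E(f)) lies in `T` by (b), and S(E(f)) lies in
`lowerConsequences` by (a). Hence N f ∈ T, and N can be cancelled. -/
theorem mem_of_isIdentity [CharZero F] {n : ℕ} (h₁ : invarianceTest n = true)
    (h₂ : inverseTest n = true) {T : Submodule F (Poly F (Fin n))}
    (hT : lowerConsequences F (Fin n) ≤ T)
    (hH : ∀ m : Mon (Fin n), m.IsMultilinear → ∀ p ∈ hooksOf (m.relabel 0),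
      ((hook p.2.1 p.2.2).mapMon (Mon.map m.leaf)).toPoly F ∈ T)
    {f : Poly F (Fin n)} (hf : f ∈ allIdentities F n) : f ∈ T := by
  rcases Nat.eq_zero_or_pos n with rfl | hn
  -- Every monomial has a leaf, so there are no monomials in an empty set of variables.
  · have : f = 0 := Finsupp.ext fun m => Fin.elim0 m.first
    rw [this]
    exact T.zero_mem
  have : NeZero n := ⟨hn.ne'⟩
  have hN : Symmetrize.factor n ≠ 0 := by
    unfold Symmetrize.factor
    split <;> norm_num
  refine mem_of_zsmul_mem hN ?_
  have h₃ := hT (symmetrizeMap_mem h₁ (expandMap_mem hf.2))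
  have h₄ : multilinear F n ≤ T.comap (Symmetrize.factor n • LinearMap.id -
      (symmetrizeMap F (Fin n) n).comp (expandMap F (Fin n))) := by
    rw [multilinear, Finsupp.supported_eq_span_single, Submodule.span_le]
    rintro _ ⟨m, hm, rfl⟩
    refine factor_smul_sub_mem h₂ hm.size_eq hT fun p hp => hH _ (fun x => ?_) p hp
    rw [(Mon.commRel_orient m).count_eq, hm x]
  convert add_mem (Submodule.mem_comap.1 (h₄ hf.1)) h₃ using 1
  simp

theorem mem_lowerConsequences_of_isIdentity [CharZero F] {n : ℕ} (hn : n < 5) {f : Poly F (Fin n)}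
    (hf : f ∈ allIdentities F n) : f ∈ lowerConsequences F (Fin n) := by
  -- In degree less than five no new relations are used, as the only entry of `hookTable` has degree
  -- five.
  have key (h : (Mon.shapes n n 0).all (fun s => (hooksOf s).isEmpty) = true)
      (h₁ : invarianceTest n = true) (h₂ : inverseTest n = true) :
      f ∈ lowerConsequences F (Fin n) := by
    refine mem_of_isIdentity h₁ h₂ le_rfl (fun m hm p hp => ?_) hf
    have hs := Mon.relabel_mem_shapes m n 0 hm.size_eq.le
    rw [hm.size_eq] at hs
    have := List.isEmpty_iff.1 (List.all_eq_true.1 h _ hs)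
    simp [this] at hp
  interval_cases n <;> exact key (by decide +kernel) (by decide +kernel) (by decide +kernel)

variable (F) in
/-- The span of the linearizations of `newJJ51` and `newJJ52` and their images under permutations. -/
noncomputable def hookSpan (o : Op) : Submodule F (Poly F (Fin 5)) :=
  Submodule.span F (Set.range fun s : Equiv.Perm (Fin 5) => permRep F 5 s (linJJ5 F o))

/-- The factor 2: among the 24 orders of the four copies of a, exchanging the two variables of the
innermost product {a, a} does not change a term modulo commutativity, and `arrangements` keeps one
order from each such pair. -/
theorem newLin5_isZeroComm (o : Op) :
    Comb.isZeroComm ((newLin5 o).toNat ++ (newTerms5 o).scale (-2)) = true := by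
  cases o <;> decide +kernel

theorem newTerms5_mem (o : Op) (s : Equiv.Perm (Fin 5)) (g : ℕ → Fin 5) (hg : ∀ i : Fin 5, g i = s i) :
    permRep F 5 s (linJJ5 F o) - (2 : ℤ) • ((newTerms5 o).mapMon (Mon.map g)).toPoly F ∈
      lowerConsequences F (Fin 5) := by
  have h := toPoly_mem_of_isZeroComm (F := F) g (newLin5_isZeroComm o)
  rw [← Comb.rename_toPoly, Comb.toPoly_append, Comb.toPoly_scale, map_add, map_zsmul,
    Comb.rename_toPoly, Comb.rename_toPoly, Comb.toNat, Comb.mapMon_mapMon] at h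
  simp only [Mon.map_map] at h
  rw [show g ∘ Fin.val = s from funext hg, ← Comb.rename_toPoly, ← linJJ5_eq] at h
  convert h using 1
  rw [neg_smul, ← sub_eq_add_neg]
  rfl

theorem inverseTest_five : inverseTest 5 = true := by decide +kernel

theorem invarianceTest_five : invarianceTest 5 = true := by decide +kernel

theorem mem_sup_hookSpan [CharZero F] {f : Poly F (Fin 5)} (hf : f ∈ allIdentities F 5) :
    f ∈ lowerConsequences F (Fin 5) ⊔ (hookSpan F .circ ⊔ hookSpan F .bullet) := by
  refine mem_of_isIdentity invarianceTest_five inverseTest_five le_sup_left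
    (fun m hm p hp => ?_) hf
  have hs := Mon.relabel_mem_shapes m 5 0 hm.size_eq.le
  rw [hm.size_eq] at hs
  have hi : p.2.2 < 5 := by
    have h : (Mon.shapes 5 5 0).all (fun s => (hooksOf s).all fun p => Nat.blt p.2.2 5) = true := by
      decide +kernel
    exact Nat.le_of_ble_eq_true (List.all_eq_true.1 (List.all_eq_true.1 h _ hs) p hp)
  rw [hook, Comb.mapMon_mapMon]
  simp only [Mon.map_map]
  obtain ⟨k, o, i⟩ := p
  dsimp only at hi ⊢
  -- The leaves of a multilinear monomial run through all five variables. Composed with the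
  -- transposition of `i` and 4 they form a permutation, so the hook is half of a permuted `linJJ5`
  -- modulo `lowerConsequences`.
  have hsurj : Function.Surjective fun j : Fin 5 => (m.leaf ∘ swapFour i) j := by
    intro x
    have hx : x ∈ m.leaves := by
      have h := hm x
      rw [Mon.count_eq] at h
      obtain ⟨y, hy, hxy⟩ := List.countP_pos_iff.1 (by rw [h]; norm_num)
      have hyx : y = x := Fin.ext (Nat.eq_of_beq_eq_true hxy)
      rwa [hyx] at hy
    obtain ⟨j, hj, rfl⟩ := List.getElem_of_mem hx
    have hj5 : j < 5 := by rwa [m.length_leaves, hm.size_eq] at hj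
    have hswap : ∀ i < 5, ∀ j < 5, swapFour i j < 5 ∧ swapFour i (swapFour i j) = j := by decide
    refine ⟨⟨swapFour i j, (hswap i hi j hj5).1⟩, ?_⟩
    simp only [Function.comp_apply, (hswap i hi j hj5).2]
    rw [Mon.leaf, List.getD_eq_getElem _ _ hj]
  let s : Equiv.Perm (Fin 5) := Equiv.ofBijective _ (Finite.surjective_iff_bijective.1 hsurj)
  have h := newTerms5_mem (F := F) o s (m.leaf ∘ swapFour i) fun _ => rfl
  have h₁ : permRep F 5 s (linJJ5 F o) ∈ hookSpan F .circ ⊔ hookSpan F .bullet := by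
    have h₂ : permRep F 5 s (linJJ5 F o) ∈ hookSpan F o := Submodule.subset_span ⟨s, rfl⟩
    cases o
    · exact Submodule.mem_sup_left h₂
    · exact Submodule.mem_sup_right h₂
  refine mem_of_zsmul_mem (k := 2) two_ne_zero ?_
  have h₂ := sub_mem (Submodule.mem_sup_right h₁) (Submodule.mem_sup_left h)
  rwa [sub_sub_cancel] at h₂

end JJ

namespace JJ

variable {F : Type*} [Field F]

/-! ### A model of the identities of degree at most four -/

/-- The products of an algebra with the basis
`a, b, a ∘ a, a ∘ b, a ∘ (a ∘ a), a • b, a • (a ∘ a), z`, in which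
`(a ∘ b) • (a ∘ (a ∘ a)) = z = (a • b) ∘ (a • (a ∘ a))` and all products that are not listed are
zero. -/
def modelMul {R : Type*} [CommRing R] : Bool → (Fin 8 → R) → (Fin 8 → R) → Fin 8 → R
  | true, x, y => ![0, 0, x 0 * y 0, x 0 * y 1 + x 1 * y 0, x 0 * y 2 + x 2 * y 0, 0, 0,
      x 5 * y 6 + x 6 * y 5]
  | false, x, y => ![0, 0, 0, 0, 0, x 0 * y 1 + x 1 * y 0, x 0 * y 2 + x 2 * y 0,
      x 3 * y 4 + x 4 * y 3]

theorem modelMul_true {R : Type*} [CommRing R] (x y : Fin 8 → R) :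
    modelMul true x y 0 = 0 ∧ modelMul true x y 1 = 0 ∧ modelMul true x y 2 = x 0 * y 0 ∧
      modelMul true x y 3 = x 0 * y 1 + x 1 * y 0 ∧ modelMul true x y 4 = x 0 * y 2 + x 2 * y 0 ∧
      modelMul true x y 5 = 0 ∧ modelMul true x y 6 = 0 ∧
      modelMul true x y 7 = x 5 * y 6 + x 6 * y 5 :=
  ⟨rfl, rfl, rfl, rfl, rfl, rfl, rfl, rfl⟩

theorem modelMul_false {R : Type*} [CommRing R] (x y : Fin 8 → R) :
    modelMul false x y 0 = 0 ∧ modelMul false x y 1 = 0 ∧ modelMul false x y 2 = 0 ∧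
      modelMul false x y 3 = 0 ∧ modelMul false x y 4 = 0 ∧
      modelMul false x y 5 = x 0 * y 1 + x 1 * y 0 ∧
      modelMul false x y 6 = x 0 * y 2 + x 2 * y 0 ∧
      modelMul false x y 7 = x 3 * y 4 + x 4 * y 3 :=
  ⟨rfl, rfl, rfl, rfl, rfl, rfl, rfl, rfl⟩

variable (F) in
/-- The operations of the model, where `o` takes the role of the first operation. -/
def modelOp (o : Op) : BilinOps F (Fin 8 → F) := fun p =>
  LinearMap.mk₂ F (modelMul (o.beq p))
    (fun x x' y => by
      cases o.beq p <;> funext i <;> fin_cases i <;> simp [modelMul] <;> ring)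
    (fun c x y => by
      cases o.beq p <;> funext i <;> fin_cases i <;> simp [modelMul] <;> ring)
    (fun x y y' => by
      cases o.beq p <;> funext i <;> fin_cases i <;> simp [modelMul] <;> ring)
    (fun c x y => by
      cases o.beq p <;> funext i <;> fin_cases i <;> simp [modelMul] <;> ring)

theorem modelOp_comm (o p : Op) (x y : Fin 8 → F) : modelOp F o p x y = modelOp F o p y x := by
  simp only [modelOp, LinearMap.mk₂_apply]
  cases o.beq p <;> funext i <;> fin_cases i <;> simp [modelMul] <;> ring

theorem eval_eq_of_commRel {X A : Type*} {op : Op → A → A → A} (hop : ∀ o x y, op o x y = op o y x)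
    (a : X → A) {m n : Mon X} (h : Mon.CommRel m n) : m.eval op a = n.eval op a := by
  induction h with
  | refl m => rfl
  | mul o _ _ hl hr => rw [Mon.eval, Mon.eval, hl, hr]
  | comm o _ _ hl hr => rw [Mon.eval, Mon.eval, hl, hr, hop]

theorem eval_toPoly_of_isZeroComm {A : Type*} [AddCommGroup A] [Module F A] {op : BilinOps F A}
    (hop : ∀ o x y, op o x y = op o y x) {n : ℕ} [NeZero n] {l : Comb (Fin n)} {l' : Comb ℕ} {k : ℤ}
    (h : Comb.isZeroComm (l.toNat ++ l'.scale (-k)) = true) (a : Fin n → A) :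
    (l.toPoly F).eval op a =
      k • l'.val fun m => m.eval (fun o x y => op o x y) fun i => a (Fin.ofNat n i) := by
  have h := Comb.val_eq_zero_of_comm (fun _ _ hmn => eval_eq_of_commRel hop
    (fun i => a (Fin.ofNat n i)) hmn) h
  rw [Comb.val_append, Comb.val_scale, neg_smul, ← sub_eq_add_neg, sub_eq_zero] at h
  rw [← h, Comb.eval_toPoly, Comb.toNat, Comb.val_mapMon]
  congr 1
  funext m
  rw [Mon.eval_map]
  congr 1
  funext i
  simp

theorem isIdentity_modelOp (o : Op) {n : ℕ} {f : Poly F (Fin n)} (hf : LowerList F n f) :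
    IsIdentity (modelOp F o) f := by
  intro a
  cases hf with
  | comm p =>
    rw [commutativity, map_sub, Poly.eval_mul, Poly.eval_mul, modelOp_comm, sub_self]
  | jordan p =>
    have h : Comb.isZeroComm ((jordanLin p).toNat ++
        (jordanTerms p (.var 0) (.var 1) (.var 2) (.var 3)).scale (-2)) = true := by
      cases p <;> decide +kernel
    rw [linearize_jordanIdentity, eval_toPoly_of_isZeroComm (modelOp_comm o) h]
    convert smul_zero _
    generalize (fun i => a (Fin.ofNat 4 i)) = b
    simp only [jordanTerms, Comb.val_cons, Comb.val_nil, Mon.eval, modelOp, LinearMap.mk₂_apply]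
    -- Here every monomial vanishes separately: products have no component at a or b, no threefold
    -- product has a component at a ∘ a, and the components that produce z under one operation arise
    -- only from the other operation.
    cases o.beq p <;> funext i <;> fin_cases i <;> simp [modelMul_true, modelMul_false]
  | new4 =>
    have h : Comb.isZeroComm (newLin4.toNat ++
        (newTerms4 (.var 0) (.var 1) (.var 2) (.var 3)).scale (-8)) = true := by
      decide +kernel
    rw [linearize_newJJ4, eval_toPoly_of_isZeroComm (modelOp_comm o) h]
    convert smul_zero _
    generalize (fun i => a (Fin.ofNat 4 i)) = b
    simp only [newTerms4, Comb.val_cons, Comb.val_nil, Mon.eval, modelOp, LinearMap.mk₂_apply]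
    -- The terms cancel in pairs, one pair for each splitting of the variables: only z can occur,
    -- and the components at a ∘ b, a ∘ (a ∘ a) of a ∘-product are equal to those at a • b, a • (a ∘
    -- a) of the corresponding •-product.
    cases o <;> funext i <;> fin_cases i <;>
      simp only [Op.beq, Fin.reduceFinMk, Fin.zero_eta, Fin.mk_one, modelMul_true, modelMul_false,
        Pi.add_apply, Pi.neg_apply, Pi.zero_apply, one_smul, neg_smul] <;> ring

/-- The elements `a` and `b` of the model: `b` if `j = i`, and `a` otherwise. -/
def modelPoint (R : Type*) [CommRing R] (i j : Fin 5) : Fin 8 → R :=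
  if j = i then ![0, 1, 0, 0, 0, 0, 0, 0] else ![1, 0, 0, 0, 0, 0, 0, 0]

variable (F) in
/-- For each `i`, the coefficient of `z` in the value of a polynomial at `b` for the variable `i`
and `a` for the others. -/
noncomputable def modelMap (o : Op) : Poly F (Fin 5) →ₗ[F] (Fin 5 →₀ F) :=
  (Finsupp.linearEquivFunOnFinite F F (Fin 5)).symm.toLinearMap.comp
    (LinearMap.pi fun i => (LinearMap.proj 7).comp (Poly.eval (modelOp F o) (modelPoint F i)))

theorem modelMap_apply (o : Op) (f : Poly F (Fin 5)) (i : Fin 5) :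
    modelMap F o f i = f.eval (modelOp F o) (modelPoint F i) 7 := rfl

theorem modelMap_permRep (o : Op) (s : Equiv.Perm (Fin 5)) (f : Poly F (Fin 5)) :
    modelMap F o (permRep F 5 s f) = naturalRep F 5 s (modelMap F o f) := by
  ext i
  have h : naturalRep F 5 s (modelMap F o f) i = modelMap F o f (s.symm i) := by
    conv_lhs => rw [← s.apply_symm_apply i]
    exact Finsupp.mapDomain_apply s.injective _ _
  rw [h, modelMap_apply, modelMap_apply]
  change Poly.eval (modelOp F o) (modelPoint F i) (Poly.rename s f) 7 = _
  have hs : modelPoint F i ∘ s = modelPoint F (s.symm i) := by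
    funext j
    simp [modelPoint, Equiv.eq_symm_apply]
  rw [Poly.eval_rename, hs]

theorem modelMap_eq_zero (o : Op) {f : Poly F (Fin 5)} (hf : f ∈ lowerConsequences F (Fin 5)) :
    modelMap F o f = 0 := by
  ext i
  rw [modelMap_apply, isIdentity_of_mem_consequences
    (S := fun n => {g | LowerList F n g}) (fun n f hf => isIdentity_modelOp o hf) hf]
  rfl

/-- The value of a monomial in the model over the integers. -/
def modelEval (o : Op) (i : ℕ) (m : Mon ℕ) : Fin 8 → ℤ :=
  m.eval (fun p => modelMul (o.beq p)) fun j => modelPoint ℤ (Fin.ofNat 5 i) (Fin.ofNat 5 j)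

theorem cast_modelMul (c : Bool) (x y : Fin 8 → ℤ) (i : Fin 8) :
    ((modelMul c x y i : ℤ) : F) = modelMul c (fun j => (x j : F)) (fun j => (y j : F)) i := by
  cases c <;> fin_cases i <;> simp [modelMul]

theorem modelMap_linJJ5_apply (o p : Op) (i : Fin 5) :
    modelMap F o (linJJ5 F p) i =
      ((2 * Comb.val (fun m => modelEval o i m 7) (newTerms5 p) : ℤ) : F) := by
  have h (m : Mon ℕ) : m.eval (fun p x y => modelOp F o p x y)
      (fun j => modelPoint F i (Fin.ofNat 5 j)) = fun j => (modelEval o i m j : F) := by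
    induction m with
    | var x =>
      funext k
      simp only [Mon.eval, modelEval, modelPoint, Fin.ofNat_val_eq_self]
      split_ifs <;> fin_cases k <;> simp
    | mul q l r hl hr =>
      funext k
      rw [Mon.eval, hl, hr]
      exact (cast_modelMul _ _ _ _).symm
  rw [modelMap_apply, linJJ5_eq, eval_toPoly_of_isZeroComm (modelOp_comm o) (newLin5_isZeroComm p)]
  have h' : ∀ l : Comb ℕ, (Comb.val (fun m => m.eval (fun p x y => modelOp F o p x y)
      (fun j => modelPoint F i (Fin.ofNat 5 j))) l) 7 =
      ((Comb.val (fun m => modelEval o i m 7) l : ℤ) : F) := by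
    intro l
    induction l with
    | nil => simp
    | cons p l ih =>
      rw [Comb.val_cons, Comb.val_cons, Pi.add_apply, ih, Pi.smul_apply, h]
      simp
  rw [Pi.smul_apply, h']
  simp

/-- The value of `modelMap` at a linearized identity. -/
theorem modelMap_linJJ5_self (o : Op) : ∃ k : ℤ, k ≠ 0 ∧ modelMap F o (linJJ5 F o) =
    (k : F) • ((5 : F) • Finsupp.single 4 1 - ∑ i, Finsupp.single i 1) := by
  have h : ∃ k : ℤ, k ≠ 0 ∧ ∀ i : Fin 5,
      2 * Comb.val (fun m => modelEval o i m 7) (newTerms5 o) = k * (if i = 4 then 4 else -1) := by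
    cases o
    -- At `i = 4` only the monomials (p ∘ 4) • (q ∘ (r ∘ s)) contribute, each of the 12 arrangements
    -- with z, and 2 · 12 = 4 · 6. The other four entries are equal by symmetry, and all entries add
    -- up to zero because the permuted identities do so modulo lower degree. The exchange of the
    -- operations maps the first new identity to minus the second, hence the sign in the other case.
    · exact ⟨6, by norm_num, by decide +kernel⟩
    · exact ⟨-6, by norm_num, by decide +kernel⟩
  obtain ⟨k, hk, h⟩ := h
  refine ⟨k, hk, Finsupp.ext fun i => ?_⟩
  rw [modelMap_linJJ5_apply, h]
  fin_cases i <;> (simp [Fin.sum_univ_five]; try norm_num)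

theorem modelMap_linJJ5_other (o : Op) : modelMap F o (linJJ5 F o.other) = 0 := by
  ext i
  rw [modelMap_linJJ5_apply]
  have h : ∀ i : Fin 5,
      2 * Comb.val (fun m => modelEval o i m 7) (newTerms5 o.other) = 0 := by
    cases o <;> decide +kernel
  rw [h]
  simp

end JJ

namespace JJ

variable {F : Type*} [Field F]

/-! ### The Specht module of the partition `(n - 1, 1)` -/

theorem isIrreducible_of_forall {G V : Type*} [Group G] [AddCommGroup V] [Module F V] [Nontrivial V]
    {ρ : Representation F G V}
    (h : ∀ U : Submodule F V, (∀ g, ∀ u ∈ U, ρ g u ∈ U) → U ≠ ⊥ → U = ⊤) : ρ.IsIrreducible := by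
  have : Nontrivial (Subrepresentation ρ) :=
    ⟨⊥, ⊤, fun e => bot_ne_top (α := Submodule F V) (congrArg Subrepresentation.toSubmodule e)⟩
  refine ⟨fun U => ?_⟩
  by_cases hU : U.toSubmodule = ⊥
  · exact Or.inl (Subrepresentation.toSubmodule_injective hU)
  · exact Or.inr (Subrepresentation.toSubmodule_injective
      (h U.toSubmodule (fun g u hu => U.apply_mem_toSubmodule g hu) hU))

theorem naturalRep_single {n : ℕ} (s : Equiv.Perm (Fin n)) (i : Fin n) (c : F) :
    naturalRep F n s (Finsupp.single i c) = Finsupp.single (s i) c :=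
  Finsupp.mapDomain_single

theorem naturalRep_apply {n : ℕ} (s : Equiv.Perm (Fin n)) (x : Fin n →₀ F) (i : Fin n) :
    naturalRep F n s x i = x (s.symm i) := by
  conv_lhs => rw [← s.apply_symm_apply i]
  exact Finsupp.mapDomain_apply s.injective _ _

theorem mem_spechtHook {n : ℕ} {x : Fin n →₀ F} :
    x ∈ (spechtHook F n).toSubmodule ↔ ∑ i, x i = 0 := by
  constructor
  · intro hx
    induction hx using Submodule.span_induction with
    | mem y hy =>
      obtain ⟨i, j, -, rfl⟩ := hy
      simp [Finsupp.single_apply]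
    | zero => simp
    | add y z _ _ hy hz => simp [Finset.sum_add_distrib, hy, hz]
    | smul c y _ hy => simp [← Finset.mul_sum, hy]
  · intro hx
    rcases isEmpty_or_nonempty (Fin n) with h | ⟨⟨k⟩⟩
    · rw [Subsingleton.elim x 0]
      exact zero_mem _
    have h : x = ∑ i, x i • (Finsupp.single i (1 : F) - Finsupp.single k 1) := by
      simp_rw [smul_sub, Finset.sum_sub_distrib, ← Finset.sum_smul, hx, zero_smul, sub_zero]
      ext j
      simp
    rw [h]
    refine Submodule.sum_mem _ fun i _ => Submodule.smul_mem _ _ ?_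
    by_cases hik : i = k
    · rw [hik, sub_self]
      exact zero_mem _
    · exact Submodule.subset_span ⟨i, k, hik, rfl⟩

theorem exists_perm_of_ne {α : Type*} [DecidableEq α] {i j p q : α} (hij : i ≠ j) (hpq : p ≠ q) :
    ∃ s : Equiv.Perm α, s i = p ∧ s j = q := by
  -- The second transposition moves the image of `j` to `q`. It leaves `p` fixed, since `p` is
  -- neither `q` nor the image of `j`.
  refine ⟨Equiv.swap (Equiv.swap i p j) q * Equiv.swap i p, ?_, ?_⟩
  · rw [Equiv.Perm.mul_apply, Equiv.swap_apply_left, Equiv.swap_apply_of_ne_of_ne _ hpq]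
    intro h
    exact hij ((Equiv.swap i p).injective ((Equiv.swap_apply_left i p).trans h))
  · rw [Equiv.Perm.mul_apply, Equiv.swap_apply_left]

/-- In characteristic zero a nonzero vector with sum zero is not constant. If its entries at i and j
differ, subtracting its image under the transposition of i and j leaves a nonzero multiple of e_i -
e_j, and double transitivity yields all other generators. -/
theorem spechtHook_le_of_mem [CharZero F] {n : ℕ} {U : Submodule F (Fin n →₀ F)}
    (hU : ∀ s, ∀ u ∈ U, naturalRep F n s u ∈ U) {x : Fin n →₀ F} (hx : x ∈ U) (hx0 : x ≠ 0)
    (hsum : ∑ i, x i = 0) : (spechtHook F n).toSubmodule ≤ U := by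
  obtain ⟨i, j, hij⟩ : ∃ i j, x i ≠ x j := by
    by_contra! h
    refine hx0 (Finsupp.ext fun i => ?_)
    have hn : n ≠ 0 := by
      rintro rfl
      exact i.elim0
    rw [Finset.sum_congr rfl fun j _ => h j i] at hsum
    simpa [hn] using hsum
  have hne : i ≠ j := fun h => hij (congrArg x h)
  have hdiff : (Finsupp.single i (1 : F) - Finsupp.single j 1 : Fin n →₀ F) ∈ U := by
    have h := Submodule.smul_mem U (x i - x j)⁻¹ (sub_mem hx (hU (Equiv.swap i j) x hx))
    convert h using 1
    ext k
    rw [Finsupp.smul_apply, Finsupp.sub_apply, Finsupp.sub_apply, naturalRep_apply,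
      Equiv.symm_swap, smul_eq_mul, Finsupp.single_apply, Finsupp.single_apply]
    have hsub := sub_ne_zero.2 hij
    by_cases hi : i = k
    · subst hi
      simp [hne.symm, hsub]
    · by_cases hj : j = k
      · subst hj
        rw [if_neg hne, if_pos rfl, Equiv.swap_apply_right]
        field_simp
        ring
      · simp [hi, hj, Equiv.swap_apply_of_ne_of_ne (Ne.symm hi) (Ne.symm hj)]
  refine Submodule.span_le.2 ?_
  rintro _ ⟨p, q, hpq, rfl⟩
  obtain ⟨s, hp, hq⟩ := exists_perm_of_ne hne hpq
  have h := hU s _ hdiff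
  rwa [map_sub, naturalRep_single, naturalRep_single, hp, hq] at h

/-- A linear map that is equivariant and injective on an invariant subspace with the Specht module
as its image identifies the two, and the subspace is irreducible. -/
theorem isIrreducible_and_nonempty_equiv [CharZero F] {n : ℕ} (hn : 2 ≤ n) {V : Type*}
    [AddCommGroup V] [Module F V] {ρ : Representation F (Equiv.Perm (Fin n)) V}
    (W : Subrepresentation ρ) (θ : V →ₗ[F] (Fin n →₀ F))
    (hθ : ∀ s v, θ (ρ s v) = naturalRep F n s (θ v))
    (hinj : ∀ w ∈ W.toSubmodule, θ w = 0 → w = 0)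
    (himage : W.toSubmodule.map θ = (spechtHook F n).toSubmodule) :
    W.toRepresentation.IsIrreducible ∧
      Nonempty (W.toRepresentation.Equiv (spechtHook F n).toRepresentation) := by
  have hmem : ∀ w ∈ W.toSubmodule, θ w ∈ (spechtHook F n).toSubmodule := fun w hw =>
    himage ▸ Submodule.mem_map_of_mem hw
  let e : W.toSubmodule ≃ₗ[F] (spechtHook F n).toSubmodule :=
    LinearEquiv.ofBijective (θ.restrict hmem) ⟨by
      refine (injective_iff_map_eq_zero _).2 fun w hw => ?_
      exact Subtype.ext (hinj w w.2 (congrArg Subtype.val hw)), by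
      rintro ⟨y, hy⟩
      rw [← himage] at hy
      obtain ⟨w, hw, rfl⟩ := hy
      exact ⟨⟨w, hw⟩, rfl⟩⟩
  have he (w : W.toSubmodule) : (e w : Fin n →₀ F) = θ w := rfl
  have hspecht : Nontrivial (spechtHook F n).toSubmodule := by
    let i : Fin n := ⟨0, by omega⟩
    let j : Fin n := ⟨1, by omega⟩
    have hij : i ≠ j := by simp [i, j]
    refine ⟨⟨Finsupp.single i 1 - Finsupp.single j 1, Submodule.subset_span ⟨i, j, hij, rfl⟩⟩, 0, ?_⟩
    intro h
    have h := DFunLike.congr_fun (congrArg Subtype.val h) i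
    simp [hij.symm] at h
  have := e.toEquiv.nontrivial
  refine ⟨isIrreducible_of_forall fun U hU hbot => ?_, ⟨Representation.Equiv.mk e fun s => ?_⟩⟩
  · obtain ⟨u, hu, hu0⟩ := Submodule.exists_mem_ne_zero_of_ne_bot hbot
    have hle : (spechtHook F n).toSubmodule ≤ U.map (θ.comp W.toSubmodule.subtype) := by
      refine spechtHook_le_of_mem ?_ (Submodule.mem_map_of_mem hu) ?_
        (mem_spechtHook.1 (hmem u u.2))
      · rintro s _ ⟨w, hw, rfl⟩
        exact ⟨_, hU s w hw, hθ s w⟩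
      · exact fun h => hu0 (Subtype.ext (hinj u u.2 h))
    refine Submodule.eq_top_iff'.2 fun w => ?_
    obtain ⟨u, hu, h⟩ := hle (hmem w w.2)
    have : u = w := e.injective (Subtype.ext h)
    exact this ▸ hu
  · ext w : 2
    exact hθ s w

theorem generatedBy_eq_span {n : ℕ} {V : Type*}
    [AddCommGroup V] [Module F V] {ρ : Representation F (Equiv.Perm (Fin n)) V} {w : Fin n → V}
    (hw : ∀ s i, ρ s (w i) = w (s i)) (k : Fin n) :
    (generatedBy ρ (w k)).toSubmodule = Submodule.span F (Set.range w) := by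
  change Submodule.span F _ = _
  congr 1
  ext v
  constructor
  · rintro ⟨s, rfl⟩
    exact ⟨s k, (hw s k).symm⟩
  · rintro ⟨i, rfl⟩
    exact ⟨Equiv.swap k i, (hw _ k).trans (by rw [Equiv.swap_apply_left])⟩

theorem map_sum_smul {n : ℕ} {V : Type*} [AddCommGroup V] [Module F V] {w : Fin n → V}
    {θ : V →ₗ[F] (Fin n →₀ F)} {c : F}
    (hθw : ∀ i, θ (w i) = c • ((n : F) • Finsupp.single i 1 - ∑ j, Finsupp.single j 1))
    (a : Fin n → F) (j : Fin n) : θ (∑ i, a i • w i) j = c * (n * a j - ∑ i, a i) := by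
  rw [map_sum, Finsupp.finsetSum_apply]
  simp only [map_smul, hθw, Finsupp.smul_apply, Finsupp.sub_apply, Finsupp.finsetSum_apply,
    Finsupp.single_apply, smul_eq_mul, Finset.sum_ite_eq', Finset.mem_univ, if_true]
  rw [mul_sub, Finset.mul_sum (s := Finset.univ) (f := a)]
  have h : ∀ i, a i * (c * ((n : F) * (if i = j then 1 else 0) - 1)) =
      (if i = j then c * (n * a i) else 0) - c * a i := by
    intro i
    split_ifs <;> ring
  rw [Finset.sum_congr rfl fun i _ => h i, Finset.sum_sub_distrib, Finset.sum_ite_eq']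
  simp

/-- If ∑ a_i w_i is killed by `θ`, then n a_j = ∑ a_i for all j. So all a_j are equal, and the
element is a multiple of ∑ w_i = 0. -/
theorem generatedBy_injOn [CharZero F] {n : ℕ} {V : Type*} [AddCommGroup V] [Module F V]
    {ρ : Representation F (Equiv.Perm (Fin n)) V} {w : Fin n → V}
    (hw : ∀ s i, ρ s (w i) = w (s i)) (hsum : ∑ i, w i = 0) {θ : V →ₗ[F] (Fin n →₀ F)} {c : F}
    (hc : c ≠ 0) (hθw : ∀ i, θ (w i) = c • ((n : F) • Finsupp.single i 1 - ∑ j, Finsupp.single j 1))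
    (k : Fin n) {x : V} (hx : x ∈ (generatedBy ρ (w k)).toSubmodule) (h0 : θ x = 0) : x = 0 := by
  rw [generatedBy_eq_span hw, Submodule.mem_span_range_iff_exists_fun] at hx
  obtain ⟨a, rfl⟩ := hx
  have hn : (n : F) ≠ 0 := Nat.cast_ne_zero.2 fun h => (h ▸ k).elim0
  have h : ∀ j, a j = (n : F)⁻¹ * ∑ i, a i := by
    intro j
    have h := map_sum_smul hθw a j
    rw [h0, Finsupp.zero_apply, eq_comm, mul_eq_zero, or_iff_right hc, sub_eq_zero] at h
    rw [← h, inv_mul_cancel_left₀ hn]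
  rw [Finset.sum_congr rfl fun i _ => by rw [h i], ← Finset.smul_sum, hsum, smul_zero]

theorem generatedBy_map_eq [CharZero F] {n : ℕ} {V : Type*} [AddCommGroup V] [Module F V]
    {ρ : Representation F (Equiv.Perm (Fin n)) V} {w : Fin n → V}
    (hw : ∀ s i, ρ s (w i) = w (s i)) {θ : V →ₗ[F] (Fin n →₀ F)} {c : F}
    (hc : c ≠ 0) (hθw : ∀ i, θ (w i) = c • ((n : F) • Finsupp.single i 1 - ∑ j, Finsupp.single j 1))
    (k : Fin n) : (generatedBy ρ (w k)).toSubmodule.map θ = (spechtHook F n).toSubmodule := by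
  have hn : (n : F) ≠ 0 := Nat.cast_ne_zero.2 fun h => (h ▸ k).elim0
  rw [generatedBy_eq_span hw]
  refine le_antisymm ?_ fun y hy => ?_
  · rw [Submodule.map_span, Submodule.span_le]
    rintro _ ⟨_, ⟨i, rfl⟩, rfl⟩
    refine mem_spechtHook.2 ?_
    rw [hθw]
    simp [Finsupp.single_apply, ← Finset.mul_sum]
  -- For coefficients a_i with sum zero the image has the entries c n a_j, so dividing `y` by c n
  -- gives a preimage.
  · refine ⟨∑ i, ((c * n)⁻¹ * y i) • w i, Submodule.sum_mem _ fun i _ => Submodule.smul_mem _ _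
      (Submodule.subset_span ⟨i, rfl⟩), Finsupp.ext fun j => ?_⟩
    rw [map_sum_smul hθw, ← Finset.mul_sum, mem_spechtHook.1 hy]
    field_simp
    ring

end JJ

namespace JJ

variable {F : Type*} [Field F]

/-! ### Subquotients -/

section SubQuot

variable {V W : Type*} [AddCommGroup V] [Module F V] [AddCommGroup W] [Module F W]
  {p q : Submodule F V}

namespace SubQuot

variable (p q) in
/-- The class of an element of `p`, as a linear map. -/
noncomputable def mkLinear : p →ₗ[F] SubQuot p q := (q.submoduleOf p).mkQ

theorem exists_eq_mk (x : SubQuot p q) : ∃ v, ∃ hv : v ∈ p, x = mk v hv := by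
  obtain ⟨⟨v, hv⟩, rfl⟩ := (q.submoduleOf p).mkQ_surjective x
  exact ⟨v, hv, rfl⟩

theorem mk_eq_zero {v : V} (hv : v ∈ p) (h : v ∈ q) : (mk v hv : SubQuot p q) = 0 :=
  (Submodule.Quotient.mk_eq_zero (q.submoduleOf p)).2 h

/-- The map that a linear map which vanishes on `q` induces on a subquotient. -/
noncomputable def lift (f : V →ₗ[F] W) (h : ∀ v ∈ q, f v = 0) : SubQuot p q →ₗ[F] W :=
  (q.submoduleOf p).liftQ (f.comp p.subtype) fun v hv => h v hv

theorem lift_mk (f : V →ₗ[F] W) (h : ∀ v ∈ q, f v = 0) {v : V} (hv : v ∈ p) :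
    (lift f h : SubQuot p q →ₗ[F] W) (mk v hv) = f v := rfl

end SubQuot

end SubQuot

/-! ### The new identities of degree five -/

theorem permRep_filter {n : ℕ} (s : Equiv.Perm (Fin n)) (f : Poly F (Fin n))
    [DecidablePred (Mon.IsMultilinear (X := Fin n))] :
    permRep F n s (f.filter Mon.IsMultilinear) = (permRep F n s f).filter Mon.IsMultilinear := by
  induction f using Finsupp.induction_linear with
  | zero => rw [Finsupp.filter_zero, map_zero, Finsupp.filter_zero]
  | add f g hf hg => rw [Finsupp.filter_add, map_add, map_add, Finsupp.filter_add, hf, hg]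
  | single m c =>
    have hs : permRep F n s (Finsupp.single m c) = Finsupp.single (m.map s) c :=
      Finsupp.mapDomain_single
    have hm : (m.map s).IsMultilinear ↔ m.IsMultilinear := by
      simp only [Mon.IsMultilinear, Mon.count_map]
      exact (s.symm.surjective.forall (p := fun x => m.count x = 1)).symm
    rw [hs]
    by_cases h : m.IsMultilinear
    · rw [Finsupp.filter_single_of_pos _ h, Finsupp.filter_single_of_pos _ (hm.2 h), hs]
    · rw [Finsupp.filter_single_of_neg _ h, Finsupp.filter_single_of_neg _ (mt hm.1 h), map_zero]

theorem permRep_linearize {n : ℕ} {X : Type*} {p : Fin n → X} {s : Equiv.Perm (Fin n)}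
    (hs : ∀ i, p (s i) = p i) (f : Poly F X) :
    permRep F n s (linearize p f) = linearize p f := by
  classical
  rw [linearize, permRep_filter]
  congr 1
  refine (Poly.rename_subst s _ f).trans ?_
  congr 2
  funext x
  rw [map_sum]
  refine Finset.sum_equiv s (fun i => by simp [hs]) fun i _ => ?_
  exact Finsupp.mapDomain_single

theorem permRep_linJJ5 (o : Op) {s : Equiv.Perm (Fin 5)} (hs : s 4 = 4) :
    permRep F 5 s (linJJ5 F o) = linJJ5 F o := by
  have hp (i : Fin 5) : (![0, 0, 0, 0, 1] : Fin 5 → Fin 2) i = if i = 4 then 1 else 0 := by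
    fin_cases i <;> rfl
  have h (i : Fin 5) : (![0, 0, 0, 0, 1] : Fin 5 → Fin 2) (s i) =
      (![0, 0, 0, 0, 1] : Fin 5 → Fin 2) i := by
    rw [hp, hp]
    exact if_congr ⟨fun h => s.injective (h.trans hs.symm), fun h => h ▸ hs⟩ rfl rfl
  cases o <;> exact permRep_linearize h _

/-- A vector fixed by the stabilizer of `k` has an orbit indexed by the points: its image under a
permutation depends only on where `k` goes. The two permutations compared here both send `k` to `s
i`. -/
theorem apply_swap_apply {α V : Type*} [DecidableEq α] [AddCommGroup V] [Module F V]
    {ρ : Representation F (Equiv.Perm α) V} {k : α} {v : V} (hv : ∀ s, s k = k → ρ s v = v)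
    (s : Equiv.Perm α) (i : α) :
    ρ s (ρ (Equiv.swap k i) v) = ρ (Equiv.swap k (s i)) v := by
  have h := hv ((Equiv.swap k (s i))⁻¹ * (s * Equiv.swap k i)) (by simp)
  conv_rhs => rw [← h, ← Module.End.mul_apply, ← map_mul, mul_inv_cancel_left]
  rw [map_mul, Module.End.mul_apply]

/-- The linearized form of setting b = a. Either new identity then becomes the part of `newJJ4` that
is linear in {a, a}, with the product taken for `o`. The list runs through the ten choices of the
two variables inside this product. -/
theorem sum_hook_isZeroComm (o : Op) :
    Comb.isZeroComm ((hook o 0 ++ (hook o 1 ++ (hook o 2 ++ (hook o 3 ++ hook o 4)))) ++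
      ([(0, 1, 2, 3, 4), (0, 2, 1, 3, 4), (0, 3, 1, 2, 4), (0, 4, 1, 2, 3), (1, 2, 0, 3, 4),
        (1, 3, 0, 2, 4), (1, 4, 0, 2, 3), (2, 3, 0, 1, 4), (2, 4, 0, 1, 3),
        (3, 4, 0, 1, 2)] : List (ℕ × ℕ × ℕ × ℕ × ℕ)).flatMap fun p =>
          (Rel.interchange (.mul o (.var p.1) (.var p.2.1)) (.var p.2.2.1) (.var p.2.2.2.1)
            (.var p.2.2.2.2)).comb.scale (-2)) = true := by
  cases o <;> decide +kernel

theorem sum_permRep_linJJ5_mem [CharZero F] (o : Op) :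
    ∑ i, permRep F 5 (Equiv.swap 4 i) (linJJ5 F o) ∈ lowerConsequences F (Fin 5) := by
  have h₁ (i : Fin 5) : permRep F 5 (Equiv.swap 4 i) (linJJ5 F o) -
      (2 : ℤ) • Poly.rename (Fin.ofNat 5) ((hook o i).toPoly F) ∈ lowerConsequences F (Fin 5) := by
    rw [Comb.rename_toPoly, hook, Comb.mapMon_mapMon]
    simp only [Mon.map_map]
    exact newTerms5_mem o _ _ (by decide +revert)
  have h₂ := toPoly_mem_of_isZeroComm (F := F) (Fin.ofNat 5) (sum_hook_isZeroComm o)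
  rw [← Comb.rename_toPoly, Comb.toPoly_append, map_add] at h₂
  have h₃ := (Submodule.add_mem_iff_left _ (by
    rw [Comb.toPoly, Comb.val_flatMap, map_list_sum]
    refine list_sum_mem fun x hx => ?_
    simp only [List.mem_map] at hx
    obtain ⟨_, ⟨p, -, rfl⟩, rfl⟩ := hx
    rw [Comb.val_scale, map_zsmul]
    refine zsmul_mem ?_ _
    have h := Rel.comb_mem (F := F) (.interchange (.mul o (.var p.1) (.var p.2.1))
      (.var p.2.2.1) (.var p.2.2.2.1) (.var p.2.2.2.2)) (Fin.ofNat 5)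
    rwa [← Comb.rename_toPoly] at h)).1 h₂
  simp only [Comb.toPoly_append, map_add] at h₃
  have h₄ := add_mem (Submodule.sum_mem _ fun i (_ : i ∈ Finset.univ) => h₁ i)
    (zsmul_mem h₃ (2 : ℤ))
  convert h₄ using 1
  rw [Finset.sum_sub_distrib, ← Finset.smul_sum, Fin.sum_univ_five (fun i : Fin 5 =>
    Poly.rename (Fin.ofNat 5) ((hook o i).toPoly F))]
  simp only [Fin.val_zero, Fin.val_one, Fin.val_two, Fin.isValue]
  rw [← add_assoc, ← add_assoc, ← add_assoc]
  exact (sub_add_cancel _ _).symm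

/-- One inclusion is the completeness of the list in degrees below five. The other holds because the
listed identities are multilinear identities of degrees two and four. -/
theorem oldIdentities_five [CharZero F] :
    oldIdentities F 5 = multilinear F 5 ⊓ lowerConsequences F (Fin 5) := by
  refine le_antisymm (inf_le_inf_left _ ?_) (inf_le_inf_left _ ?_)
  · exact consequences_le_consequences fun n f hf => mem_lowerConsequences_of_isIdentity hf.1 hf.2
  · refine consequences_le_consequences fun n f hf => ?_
    refine mem_consequences (S := fun k => {f | k < 5 ∧ f ∈ allIdentities F k})
      ⟨?_, lowerList_mem hf⟩
    cases hf <;> norm_num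

theorem newRep_newClass {n : ℕ} (s : Equiv.Perm (Fin n)) {f : Poly F (Fin n)}
    (hf : f ∈ allIdentities F n) :
    newRep F n s (newClass f hf) = newClass (permRep F n s f) (permRep_mem_all s hf) := rfl

theorem newClass_eq_zero [CharZero F] {f : Poly F (Fin 5)} (hf : f ∈ allIdentities F 5)
    (h : f ∈ lowerConsequences F (Fin 5)) : newClass f hf = 0 := by
  refine SubQuot.mk_eq_zero _ ?_
  rw [oldIdentities_five]
  exact ⟨hf.1, h⟩

/-- The map that `modelMap` induces on the new identities. -/
noncomputable def newMap [CharZero F] (o : Op) : NewIdentities F 5 →ₗ[F] (Fin 5 →₀ F) :=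
  SubQuot.lift (modelMap F o) fun f hf => by
    rw [oldIdentities_five] at hf
    exact modelMap_eq_zero o hf.2

theorem newMap_newClass [CharZero F] (o : Op) {f : Poly F (Fin 5)} (hf : f ∈ allIdentities F 5) :
    newMap o (newClass f hf) = modelMap F o f := SubQuot.lift_mk _ _ _

theorem newMap_newRep [CharZero F] (o : Op) (s : Equiv.Perm (Fin 5)) (x : NewIdentities F 5) :
    newMap o (newRep F 5 s x) = naturalRep F 5 s (newMap o x) := by
  obtain ⟨f, hf, rfl⟩ := x.exists_eq_mk
  change newMap o (newRep F 5 s (newClass f hf)) = naturalRep F 5 s (newMap o (newClass f hf))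
  rw [newRep_newClass, newMap_newClass, newMap_newClass, modelMap_permRep]

variable (F) in
/-- The classes of the permuted linearizations. -/
noncomputable def newHook (o : Op) (i : Fin 5) : NewIdentities F 5 :=
  newRep F 5 (Equiv.swap 4 i) (newClass (linJJ5 F o) (linJJ5_mem o))

theorem newHook_four (o : Op) : newHook F o 4 = newClass (linJJ5 F o) (linJJ5_mem o) := by
  rw [newHook, Equiv.swap_self, ← Equiv.Perm.one_def, map_one, Module.End.one_apply]

theorem newRep_newHook (o : Op) (s : Equiv.Perm (Fin 5)) (i : Fin 5) :
    newRep F 5 s (newHook F o i) = newHook F o (s i) := by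
  refine apply_swap_apply (fun s hs => ?_) s i
  rw [newRep_newClass]
  congr 1
  exact permRep_linJJ5 o hs

theorem sum_newHook [CharZero F] (o : Op) : ∑ i, newHook F o i = 0 := by
  have h : ∑ i, newHook F o i = newClass (∑ i, permRep F 5 (Equiv.swap 4 i) (linJJ5 F o))
      (Submodule.sum_mem _ fun i _ => permRep_mem_all _ (linJJ5_mem o)) := by
    have h := map_sum (SubQuot.mkLinear (allIdentities F 5) (oldIdentities F 5)) (fun i : Fin 5 => (⟨_, permRep_mem_all (Equiv.swap 4 i)
      (linJJ5_mem o)⟩ : allIdentities F 5)) Finset.univ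
    refine h.symm.trans (congrArg (SubQuot.mkLinear (allIdentities F 5) (oldIdentities F 5)) (Subtype.ext ?_))
    simp
  rw [h]
  exact newClass_eq_zero _ (sum_permRep_linJJ5_mem o)

theorem newMap_newHook [CharZero F] (o : Op) : ∃ c : F, c ≠ 0 ∧ ∀ i, newMap o (newHook F o i) =
    c • (((5 : ℕ) : F) • Finsupp.single i 1 - ∑ j, Finsupp.single j 1) := by
  obtain ⟨k, hk, h⟩ := modelMap_linJJ5_self (F := F) o
  refine ⟨k, Int.cast_ne_zero.2 hk, fun i => ?_⟩
  rw [newHook, newMap_newRep, newMap_newClass, h, map_smul, map_sub, map_smul, map_sum]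
  simp only [naturalRep_single, Equiv.swap_apply_left, Nat.cast_ofNat]
  rw [Equiv.sum_comp (Equiv.swap 4 i) fun j => Finsupp.single j (1 : F)]

variable (F) in
/-- The subrepresentation generated by the class of a new identity. -/
noncomputable abbrev newGenerated (o : Op) : Subrepresentation (newRep F 5) :=
  generatedBy (newRep F 5) (newClass (linJJ5 F o) (linJJ5_mem o))

theorem newGenerated_isIrreducible [CharZero F] (o : Op) :
    (newGenerated F o).toRepresentation.IsIrreducible ∧
      Nonempty ((newGenerated F o).toRepresentation.Equiv (spechtHook F 5).toRepresentation) := by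
  obtain ⟨c, hc, hθ⟩ := newMap_newHook (F := F) o
  rw [newGenerated, ← newHook_four]
  exact isIrreducible_and_nonempty_equiv (by norm_num) _ (newMap o) (newMap_newRep o)
    (fun w hw h => generatedBy_injOn (newRep_newHook o) (sum_newHook o) hc hθ 4 hw h)
    (generatedBy_map_eq (newRep_newHook o) hc hθ 4)

theorem hookSpan_le (o : Op) : hookSpan F o ≤ allIdentities F 5 := by
  refine Submodule.span_le.2 ?_
  rintro _ ⟨s, rfl⟩
  exact permRep_mem_all s (linJJ5_mem o)

theorem newClass_mem_newGenerated (o : Op) {f : Poly F (Fin 5)} (hf : f ∈ hookSpan F o) :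
    newClass f (hookSpan_le o hf) ∈ (newGenerated F o).toSubmodule := by
  induction hf using Submodule.span_induction with
  | mem g hg =>
    obtain ⟨s, rfl⟩ := hg
    exact Submodule.subset_span ⟨s, rfl⟩
  | zero => exact zero_mem _
  | add g g' _ _ hg hg' => exact add_mem hg hg'
  | smul c g _ hg => exact Submodule.smul_mem _ c hg

theorem isCompl_newGenerated [CharZero F] :
    IsCompl (newGenerated F .circ).toSubmodule (newGenerated F .bullet).toSubmodule := by
  constructor
  · rw [Submodule.disjoint_def]
    intro x hx hx'
    obtain ⟨c, hc, hθ⟩ := newMap_newHook (F := F) .circ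
    rw [newGenerated, ← newHook_four] at hx
    refine generatedBy_injOn (newRep_newHook _) (sum_newHook _) hc hθ 4 hx ?_
    -- The map that is injective on the first submodule vanishes on the second one, so the two
    -- intersect trivially.
    have hle : (newGenerated F .bullet).toSubmodule ≤ LinearMap.ker (newMap (F := F) .circ) := by
      refine Submodule.span_le.2 ?_
      rintro _ ⟨s, rfl⟩
      refine LinearMap.mem_ker.2 ((newMap_newRep _ _ _).trans ?_)
      rw [newMap_newClass, show Op.bullet = Op.circ.other from rfl, modelMap_linJJ5_other, map_zero]
    exact hle hx'
  · rw [codisjoint_iff, Submodule.eq_top_iff']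
    intro x
    obtain ⟨f, hf, rfl⟩ := x.exists_eq_mk
    obtain ⟨l, hl, r, hr, rfl⟩ := Submodule.mem_sup.1 (mem_sup_hookSpan hf)
    obtain ⟨c, hc, b, hb, rfl⟩ := Submodule.mem_sup.1 hr
    have hcb := add_mem (hookSpan_le _ hc) (hookSpan_le _ hb)
    -- The summand from `lowerConsequences` need not be multilinear a priori. It is, being a
    -- difference of multilinear identities, and therefore its class is defined and zero.
    have hl' : l ∈ allIdentities F 5 := by
      have h := sub_mem hf hcb
      rwa [add_sub_cancel_right] at h
    have h : newClass (l + (c + b)) hf = newClass l hl' +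
        (newClass c (hookSpan_le _ hc) + newClass b (hookSpan_le _ hb)) := rfl
    change newClass (l + (c + b)) hf ∈ _
    rw [h, newClass_eq_zero hl' hl, zero_add]
    exact Submodule.add_mem_sup (newClass_mem_newGenerated _ hc) (newClass_mem_newGenerated _ hb)

theorem fullList_mem {n : ℕ} {f : Poly F (Fin n)} (h : FullList F n f) : f ∈ allIdentities F n := by
  cases h with
  | lower h => exact lowerList_mem h
  | new51 => exact linJJ5_mem .circ
  | new52 => exact linJJ5_mem .bullet

theorem hookSpan_le_consequences (o : Op) :
    hookSpan F o ≤ consequences (fun n => {g | FullList F n g}) (Fin 5) := by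
  refine Submodule.span_le.2 ?_
  rintro _ ⟨s, rfl⟩
  refine rename_mem_consequences _ s (mem_consequences (S := fun n => {g | FullList F n g}) ?_)
  cases o
  · exact FullList.new51
  · exact FullList.new52

theorem lowerConsequences_le :
    lowerConsequences F (Fin 5) ≤ consequences (fun n => {g | FullList F n g}) (Fin 5) :=
  consequences_le_consequences fun _ _ hf =>
    mem_consequences (S := fun n => {g | FullList F n g}) (FullList.lower hf)

end JJ

/-! ### The main theorem -/

open JJ
theorem mainTheorem5 (F : Type*) [Field F] [CharZero F] :
    -- the degree five identities are exactly the consequences of the listed identities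
    (∀ f ∈ multilinear F 5,
      IsIdentity (jordan (FreeAI.op F ℕ)) f ↔ f ∈ consequences (fun n => {g | FullList F n g}) (Fin 5)) ∧
    -- those which come from lower degree are the consequences of the listed ones of lower degree
    oldIdentities F 5 = multilinear F 5 ⊓ consequences (fun n => {g | LowerList F n g}) (Fin 5) ∧
    -- modulo the latter there are exactly two irreducible identities, both of type `(4, 1)`
    ∃ (h₁ : linJJ51 F ∈ allIdentities F 5) (h₂ : linJJ52 F ∈ allIdentities F 5),
      (generatedBy (newRep F 5) (newClass (linJJ51 F) h₁)).toRepresentation.IsIrreducible ∧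
      (generatedBy (newRep F 5) (newClass (linJJ52 F) h₂)).toRepresentation.IsIrreducible ∧
      Nonempty ((generatedBy (newRep F 5) (newClass (linJJ51 F) h₁)).toRepresentation.Equiv
        (spechtHook F 5).toRepresentation) ∧
      Nonempty ((generatedBy (newRep F 5) (newClass (linJJ52 F) h₂)).toRepresentation.Equiv
        (spechtHook F 5).toRepresentation) ∧
      IsCompl (generatedBy (newRep F 5) (newClass (linJJ51 F) h₁)).toSubmodule
        (generatedBy (newRep F 5) (newClass (linJJ52 F) h₂)).toSubmodule := by
  refine ⟨fun f hf => ⟨fun h => ?_, fun h => ?_⟩, oldIdentities_five, linJJ5_mem .circ,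
    linJJ5_mem .bullet, (newGenerated_isIrreducible .circ).1, (newGenerated_isIrreducible .bullet).1,
    (newGenerated_isIrreducible .circ).2, (newGenerated_isIrreducible .bullet).2,
    isCompl_newGenerated⟩
  · have hle := sup_le (lowerConsequences_le (F := F)) (sup_le (hookSpan_le_consequences .circ)
      (hookSpan_le_consequences .bullet))
    exact hle (mem_sup_hookSpan ⟨hf, h⟩)
  · exact isIdentity_of_mem_consequences (S := fun n => {g | FullList F n g})
      (fun _ _ hg => (fullList_mem hg).2) h
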